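/- Let $(M,d)$ be a complete metric space, $(\Omega,\mathcal A,\mathbf P)$ a probability space, $T:\Omega\to\Omega$ a measurable $\mathbf P$-preserving map, and $1\le p<\infty$. Let $\mathcal P^p(M)$ be the set of Borel probability measures $\mu$ on $M$ with $\mu(\operatorname{supp}\mu)=1$ and $\int_M d(x,y)^p\,d\mu(y)<\infty$ for some $x\in M$, with the $p$-Wasserstein distance $$d_p^W(\mu,\nu)=\Bigl[\inf_\pi\int_{M\times M} d(x,y)^p\,d\pi(x,y)\Bigr]^{1/p},$$ the infimum being over all couplings $\pi$ of $\mu$ and $\nu$. Let $\mathcal C_p(M)$ be the set of $p$-contractive barycentric maps, that is, maps $\beta:\mathcal P^p(M)\to M$ with $\beta(\delta_x)=x$ for all $x\in M$ and $d(\beta(\mu),\beta(\nu))\le d_p^W(\mu,\nu)$ for all $\mu,\nu\in\mathcal P^p(M)$. It carries the metric $$d_p(\beta_1,\beta_2)=\sup\frac{d(\beta_1(\mathbf x),\beta_2(\mathbf x))}{\Delta(\mathbf x)},$$ the supremum being over all $n\ge 1$ and all $\mathbf x=(x_1,\dots,x_n)\in M^n$ with diameter $\Delta(\mathbf x)\ne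 0$, where $\beta(\mathbf x):=\beta\bigl(\frac1n\sum_{j=1}^n\delta_{x_j}\bigr)$ (the supremum of the empty set being $0$). Let $L^p(\Omega;M)$ be the set of (a.e. classes of) strongly measurable $\varphi:\Omega\to M$ with $\int_\Omega d(x,\varphi)^p\,d\mathbf P<\infty$ for some $x\in M$, with the metric $\mathbf d_p(\varphi,\psi)=\bigl[\int_\Omega d(\varphi,\psi)^p\,d\mathbf P\bigr]^{1/p}$. For $\beta\in\mathcal C_p(M)$ and $\varphi\in L^p(\Omega;M)$ put $E^\beta(\varphi):=\beta(\varphi_*\mathbf P)$, and let $\Gamma_\beta(\varphi)$ be the a.e. limit $$\Gamma_\beta(\varphi)(\omega)=\lim_{n\to\infty}\beta\Bigl(\frac1n\sum_{k=0}^{n-1}\delta_{\varphi(T^k\omega)}\Bigr).$$ Then the following hold. (0) For all $\beta\in\mathcal C_p(M)$ and $\varphi\in L^p(\Omega;M)$ this limit exists for a.e. $\omega$, $\Gamma_\beta(\varphi)$ belongs to $L^p(\Omega;M)$, and $\Gamma_\beta(\varphi)\circ T=\Gamma_\beta(\varphi)$ a.e. (1) The map $\Gamma:(\beta,\varphi)\mapsto\Gamma_\beta(\varphi)$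 is continuous from $\mathcal C_p(M)\times L^p(\Omega;M)$ to $L^p(\Omega;M)$ with respect to the product metric of $d_p$ and $\mathbf d_p$; that is, if $\beta_k\to\beta$ in $d_p$ and $\varphi_k\to\varphi$ in $\mathbf d_p$, then $\Gamma_{\beta_k}(\varphi_k)\to\Gamma_\beta(\varphi)$ in $\mathbf d_p$. (2) If $T$ is ergodic, $\beta_k\to\beta$ in $d_p$ and $\varphi_k\to\varphi$ in $\mathbf d_p$, then $E^{\beta_k}(\varphi_k)\to E^\beta(\varphi)$ in $M$. (3) If $(\Omega,\mathcal A)$ is a standard Borel space and $\beta_k\to\beta$ in $d_p$, then for every $\varphi\in L^p(\Omega;M)$, $\Gamma_{\beta_k}(\varphi)(\omega)\to\Gamma_\beta(\varphi)(\omega)$ for a.e. $\omega\in\Omega$. -/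

import Mathlib

open MeasureTheory Filter Topology
open scoped ENNReal

namespace BaryErgodic

noncomputable section

/-! ### Probability measures with full support and finite `p`-th moment -/

/-- `μ` is a Borel probability measure on `M` of full support (its support has measure one) and
with finite `p`-th moment about some point of `M`. -/
structure IsWassersteinMeasure {M : Type*} [MetricSpace M] [MeasurableSpace M]
    (p : ℝ) (μ : Measure M) : Prop where
  isProbabilityMeasure : IsProbabilityMeasure μ
  support_full : μ μ.supportᶜ = 0
  moment_finite : ∃ x : M, ∫⁻ y, edist x y ^ p ∂μ < ∞

/-- The space `𝒫^p(M)`. -/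
def PMeas (M : Type*) [MetricSpace M] [MeasurableSpace M] (p : ℝ) : Type _ :=
  {μ : Measure M // IsWassersteinMeasure p μ}

/-- `π` is a coupling of `μ` and `ν`: its two marginals are `μ` and `ν`. The `σ`-algebra of `M × M`
is the product one. Measures of full support live on a closed separable set `S`, so their couplings
live on `S × S`, where the product `σ`-algebra is the Borel one; hence it makes no difference
whether couplings are taken on the product or on the Borel `σ`-algebra, and couplings have full
support automatically. -/
def IsCoupling {M : Type*} [MeasurableSpace M] (π : Measure (M × M)) (μ ν : Measure M) : Prop :=
  π.map Prod.fst = μ ∧ π.map Prod.snd = ν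

/-- The `p`-Wasserstein distance
`[inf { ∫ d(x,y)^p dπ(x,y) : π a coupling of μ and ν }]^{1/p}`. -/
def wasserstein {M : Type*} [MetricSpace M] [MeasurableSpace M] (p : ℝ) (μ ν : Measure M) : ℝ≥0∞ :=
  (⨅ π : {π : Measure (M × M) // IsCoupling π μ ν},
    ∫⁻ z, edist z.1 z.2 ^ p ∂(π : Measure (M × M))) ^ (1 / p)

/-! ### The space `L^p(Ω; M)` -/

/-- `L^p(Ω, P; M)`: the `P`-a.e. classes of strongly measurable maps `f : Ω → M` such that
`∫ d(x, f)^p dP < ∞` for some `x ∈ M`. -/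
def LpMap {Ω : Type*} [MeasurableSpace Ω] (M : Type*) [MetricSpace M] (p : ℝ) (P : Measure Ω) :
    Type _ :=
  {f : Ω →ₘ[P] M // ∃ x : M, ∫⁻ ω, edist x (f ω) ^ p ∂P < ∞}

section Facts

variable {Ω M : Type*} [MeasurableSpace Ω] [MetricSpace M]

/-- A class in `L^p(Ω; M)` is used as a function through its chosen representative. -/
instance (p : ℝ) (P : Measure Ω) : CoeFun (LpMap M p P) (fun _ => Ω → M) := ⟨fun f => f.1⟩

theorem LpMap.aestronglyMeasurable {p : ℝ} {P : Measure Ω} (f : LpMap M p P) :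
    AEStronglyMeasurable f P := f.1.aestronglyMeasurable

theorem lintegral_triangle {p : ℝ} (hp : 1 ≤ p) {P : Measure Ω} {f g h : Ω → M}
    (hf : AEStronglyMeasurable f P) (hg : AEStronglyMeasurable g P)
    (hh : AEStronglyMeasurable h P) :
    (∫⁻ ω, edist (f ω) (h ω) ^ p ∂P) ^ (1 / p) ≤
      (∫⁻ ω, edist (f ω) (g ω) ^ p ∂P) ^ (1 / p) + (∫⁻ ω, edist (g ω) (h ω) ^ p ∂P) ^ (1 / p) := by
  have hp0 : 0 ≤ p := zero_le_one.trans hp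
  refine le_trans ?_ (ENNReal.lintegral_Lp_add_le (hf.edist hg) (hg.edist hh) hp)
  refine ENNReal.rpow_le_rpow (lintegral_mono fun ω => ?_) (by positivity)
  exact ENNReal.rpow_le_rpow (edist_triangle _ _ _) hp0

/-- The distance `𝐝_p(f, g) = [∫ d(f, g)^p dP]^{1/p}`, as an extended metric. -/
instance (p : ℝ) [hp : Fact (1 ≤ p)] (P : Measure Ω) : EMetricSpace (LpMap M p P) where
  edist f g := (∫⁻ ω, edist (f ω) (g ω) ^ p ∂P) ^ (1 / p)
  edist_self f := by
    have : 0 < p := zero_lt_one.trans_le hp.out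
    simp [this]
  edist_comm f g := by simp only [edist_comm]
  edist_triangle f g h := lintegral_triangle hp.out f.aestronglyMeasurable
    g.aestronglyMeasurable h.aestronglyMeasurable
  eq_of_edist_eq_zero {f g} h := by
    have hp0 : 0 < p := zero_lt_one.trans_le hp.out
    have h1 : ∫⁻ ω, edist (f ω) (g ω) ^ p ∂P = 0 := by
      rcases ENNReal.rpow_eq_zero_iff.1 h with h | h
      · exact h.1
      · exact absurd h.2 (not_lt.2 (by positivity))
    rw [lintegral_eq_zero_iff'
      ((f.aestronglyMeasurable.edist g.aestronglyMeasurable).pow_const p)] at h1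
    refine Subtype.ext (AEEqFun.ext ?_)
    filter_upwards [h1] with ω hω
    have : edist (f ω) (g ω) = 0 := by simpa [hp0, hp0.not_gt] using hω
    exact edist_eq_zero.1 this

/-- The metric `𝐝_p` on `L^p(Ω; M)`. -/
instance (p : ℝ) [hp : Fact (1 ≤ p)] (P : Measure Ω) [IsProbabilityMeasure P] :
    MetricSpace (LpMap M p P) :=
  EMetricSpace.toMetricSpace fun f g => by
    have hp0 : 0 < p := zero_lt_one.trans_le hp.out
    obtain ⟨x, hx⟩ := f.2
    obtain ⟨y, hy⟩ := g.2
    have hfx : (∫⁻ ω, edist (f ω) x ^ p ∂P) ^ (1 / p) < ∞ := by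
      simp only [edist_comm _ x]
      exact ENNReal.rpow_lt_top_of_nonneg (by positivity) hx.ne
    have hyg : (∫⁻ ω, edist y (g ω) ^ p ∂P) ^ (1 / p) < ∞ :=
      ENNReal.rpow_lt_top_of_nonneg (by positivity) hy.ne
    have hxy : (∫⁻ _ : Ω, edist x y ^ p ∂P) ^ (1 / p) < ∞ := by
      refine ENNReal.rpow_lt_top_of_nonneg (by positivity) ?_
      simpa using ENNReal.rpow_ne_top_of_nonneg hp0.le (edist_ne_top x y)
    have h1 := lintegral_triangle hp.out f.aestronglyMeasurable
      (aestronglyMeasurable_const (b := x)) g.aestronglyMeasurable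
    have h2 := lintegral_triangle hp.out (aestronglyMeasurable_const (μ := P) (b := x))
      (aestronglyMeasurable_const (b := y)) g.aestronglyMeasurable
    exact (h1.trans_lt (ENNReal.add_lt_top.2
      ⟨hfx, h2.trans_lt (ENNReal.add_lt_top.2 ⟨hxy, hyg⟩)⟩)).ne

variable [MeasurableSpace M]

/-- A measure that is carried by a separable set is carried by its support. -/
theorem measure_compl_support_of_isSeparable (μ : Measure M) {t : Set M}
    (ht : TopologicalSpace.IsSeparable t) (h : μ tᶜ = 0) : μ μ.supportᶜ = 0 := by
  have := ht.separableSpace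
  have hsec : SecondCountableTopology t := UniformSpace.secondCountable_of_separable t
  have hL : IsLindelof (t ∩ μ.supportᶜ) := by
    have h1 : IsLindelof ((↑) ⁻¹' μ.supportᶜ : Set t) := HereditarilyLindelofSpace.isLindelof _
    have h2 := h1.image (f := ((↑) : t → M)) continuous_subtype_val
    rwa [Subtype.image_preimage_coe] at h2
  have h0 : (t ∩ μ.supportᶜ)ᶜ ∈ ae μ := by
    refine hL.compl_mem_sets_of_nhdsWithin ?_
    rintro x ⟨-, hx⟩
    obtain ⟨U, hU, hU0⟩ := Measure.notMem_support_iff_exists.1 hx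
    exact ⟨U, mem_nhdsWithin_of_mem_nhds hU, compl_mem_ae_iff.2 hU0⟩
  refine measure_mono_null (t := tᶜ ∪ (t ∩ μ.supportᶜ)) ?_
    (measure_union_null h (compl_mem_ae_iff.1 h0))
  intro x hx
  by_cases hxt : x ∈ t
  · exact Or.inr ⟨hxt, hx⟩
  · exact Or.inl hxt

variable [BorelSpace M]

theorem LpMap.isWassersteinMeasure_map {p : ℝ} {P : Measure Ω} [IsProbabilityMeasure P]
    (f : LpMap M p P) : IsWassersteinMeasure p (P.map f) where
  isProbabilityMeasure := Measure.isProbabilityMeasure_map f.aestronglyMeasurable.aemeasurable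
  support_full := by
    obtain ⟨t, ht, hft⟩ := f.aestronglyMeasurable.isSeparable_ae_range
    refine measure_compl_support_of_isSeparable _ ht.closure ?_
    rw [Measure.map_apply_of_aemeasurable f.aestronglyMeasurable.aemeasurable
      isClosed_closure.measurableSet.compl, ← compl_compl (f ⁻¹' (closure t)ᶜ), ← mem_ae_iff]
    filter_upwards [hft] with ω hω
    simpa using subset_closure hω
  moment_finite := by
    obtain ⟨x, hx⟩ := f.2
    refine ⟨x, ?_⟩
    rwa [lintegral_map' (by fun_prop) f.aestronglyMeasurable.aemeasurable]

theorem isWassersteinMeasure_dirac (p : ℝ) [hp : Fact (1 ≤ p)] (x : M) :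
    IsWassersteinMeasure p (Measure.dirac x) where
  isProbabilityMeasure := inferInstance
  support_full := by
    refine measure_compl_support_of_isSeparable _ (Set.finite_singleton x).isSeparable ?_
    simp [Measure.dirac_apply' x (measurableSet_singleton x).compl]
  moment_finite := ⟨x, by
    have : 0 < p := zero_lt_one.trans_le hp.out
    simp [lintegral_dirac, this]⟩

/-- The uniform measure `n⁻¹ ∑_j δ_{x_j}` of an `n`-tuple. -/
def tupleMeasure {n : ℕ} (x : Fin n → M) : Measure M :=
  (n : ℝ≥0∞)⁻¹ • ∑ j, Measure.dirac (x j)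

theorem isWassersteinMeasure_tupleMeasure (p : ℝ) [hp : Fact (1 ≤ p)] {n : ℕ}
    (x : Fin (n + 1) → M) : IsWassersteinMeasure p (tupleMeasure x) where
  isProbabilityMeasure := ⟨by
    simp only [tupleMeasure, Measure.smul_apply, Measure.coe_finsetSum, Finset.sum_apply,
      measure_univ, Finset.sum_const, Finset.card_univ, Fintype.card_fin, nsmul_eq_mul, mul_one,
      smul_eq_mul]
    exact ENNReal.inv_mul_cancel (by simp) (by finiteness)⟩
  support_full := by
    refine measure_compl_support_of_isSeparable _ (Set.finite_range x).isSeparable ?_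
    simp [tupleMeasure, Measure.dirac_apply' _ (Set.finite_range x).measurableSet.compl]
  moment_finite := ⟨x 0, by
    have hp0 : 0 < p := zero_lt_one.trans_le hp.out
    simp only [tupleMeasure, lintegral_smul_measure, lintegral_finsetSum_measure, lintegral_dirac,
      smul_eq_mul]
    refine ENNReal.mul_lt_top (by simp) (ENNReal.sum_lt_top.2 fun j _ => ?_)
    exact ENNReal.rpow_lt_top_of_nonneg hp0.le (edist_ne_top _ _)⟩

end Facts

section Barycenter

variable {Ω M : Type*} [MeasurableSpace Ω] [MetricSpace M] [MeasurableSpace M] [BorelSpace M]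

/-- The point mass `δ_x` as an element of `𝒫^p(M)`. -/
def diracP (p : ℝ) [Fact (1 ≤ p)] (x : M) : PMeas M p :=
  ⟨Measure.dirac x, isWassersteinMeasure_dirac p x⟩

/-- `(n+1)⁻¹ ∑_j δ_{x_j}` as an element of `𝒫^p(M)`. -/
def tupleP (p : ℝ) [Fact (1 ≤ p)] {n : ℕ} (x : Fin (n + 1) → M) : PMeas M p :=
  ⟨tupleMeasure x, isWassersteinMeasure_tupleMeasure p x⟩

/-- The law `f_* P` of `f ∈ L^p(Ω; M)` as an element of `𝒫^p(M)`. -/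
def LpMap.law {p : ℝ} {P : Measure Ω} [IsProbabilityMeasure P] (f : LpMap M p P) : PMeas M p :=
  ⟨P.map f, f.isWassersteinMeasure_map⟩

variable (M) in
/-- The set `𝒞_p(M)` of `p`-contractive barycentric maps `β : 𝒫^p(M) → M`. -/
structure BaryMap (p : ℝ) [Fact (1 ≤ p)] where
  toFun : PMeas M p → M
  map_dirac : ∀ x, toFun (diracP p x) = x
  contractive : ∀ μ ν : PMeas M p, edist (toFun μ) (toFun ν) ≤ wasserstein p μ.1 ν.1

instance (p : ℝ) [Fact (1 ≤ p)] : CoeFun (BaryMap M p) (fun _ => PMeas M p → M) :=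
  ⟨BaryMap.toFun⟩

/-- The distance `d_p(β₁, β₂) = sup d(β₁(x), β₂(x)) / Δ(x)`, the supremum being over all tuples
`x = (x_1, …, x_n)` of points of `M`, of any length `n ≥ 1`, with diameter `Δ(x) ≠ 0`, where
`β(x)` stands for `β(n⁻¹ ∑_j δ_{x_j})`. That distinct maps have positive distance is not needed
for the topology, so only the pseudometric axioms are recorded. -/
instance (p : ℝ) [Fact (1 ≤ p)] : PseudoEMetricSpace (BaryMap M p) where
  edist β₁ β₂ := ⨆ (n : ℕ) (x : Fin (n + 1) → M) (_ : Metric.ediam (Set.range x) ≠ 0),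
    edist (β₁ (tupleP p x)) (β₂ (tupleP p x)) / Metric.ediam (Set.range x)
  edist_self β := by simp
  edist_comm β₁ β₂ := by simp only [edist_comm]
  edist_triangle β₁ β₂ β₃ := by
    refine iSup_le fun n => iSup_le fun x => iSup_le fun hx => ?_
    refine (ENNReal.div_le_div_right (edist_triangle _ (β₂ (tupleP p x)) _) _).trans ?_
    rw [ENNReal.add_div]
    refine add_le_add ?_ ?_
    · exact le_iSup_of_le n (le_iSup_of_le x (le_iSup_of_le hx le_rfl))
    · exact le_iSup_of_le n (le_iSup_of_le x (le_iSup_of_le hx le_rfl))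

/-- The `β`-expectation `E^β(f) = β(f_* P)`. -/
def expect {p : ℝ} [Fact (1 ≤ p)] {P : Measure Ω} [IsProbabilityMeasure P] (β : BaryMap M p)
    (f : LpMap M p P) : M :=
  β f.law

/-- `empirical T f n ω` is the empirical measure of length `n + 1`,
`(n+1)⁻¹ ∑_{k=0}^{n} δ_{f(T^k ω)}`. -/
def empirical {p : ℝ} [Fact (1 ≤ p)] {P : Measure Ω} (T : Ω → Ω) (f : LpMap M p P) (n : ℕ)
    (ω : Ω) : PMeas M p :=
  tupleP p fun k : Fin (n + 1) => f (T^[k] ω)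

/-- `g` is the a.e. limit of the barycenters of the empirical measures of `f`. -/
def IsErgodicLimit {p : ℝ} [Fact (1 ≤ p)] {P : Measure Ω} (T : Ω → Ω) (β : BaryMap M p)
    (f g : LpMap M p P) : Prop :=
  ∀ᵐ ω ∂P, Tendsto (fun n => β (empirical T f n ω)) atTop (𝓝 (g ω))

open Classical in
/-- The map `Γ_β : L^p(Ω; M) → L^p(Ω; M)`: the a.e. limit of the barycenters of the empirical
measures (with an irrelevant value where there is no such limit in `L^p(Ω; M)`). -/
def Gam {p : ℝ} [Fact (1 ≤ p)] {P : Measure Ω} (T : Ω → Ω) (β : BaryMap M p)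
    (f : LpMap M p P) : LpMap M p P :=
  if h : ∃ g : LpMap M p P, IsErgodicLimit T β f g then h.choose else f

end Barycenter

end

end BaryErgodic

/-! Suppose first that `φ` takes finitely many values. Its empirical measures then live on a fixed
finite set `F`, and their masses are visit frequencies, which converge a.e. by Birkhoff's theorem
for indicators. Two probability measures on `F` with nearly equal masses are Wasserstein close,
since only the unshared mass has to move, by at most the diameter of `F`. By contractivity the
barycenters form a Cauchy sequence.

For general `φ`, coupling along the orbit bounds the distance between the barycenters of `φ` and `ψ`
by the `1/p`-th power of the orbit average of `d(φ, ψ)^p`. The maximal ergodic inequality makes the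
upper limit of these averages arbitrarily small a.e. along simple functions tending to `φ` in `𝐝_p`.
Neither this bound nor the exceptional null set depends on `β`. Completeness then gives the limit.

By Fatou, `Γ_β` is 1-Lipschitz in `φ`. For `φ` with values in `F`, the distance between `Γ_β(φ)` and
`Γ_β'(φ)` is at most `d_p(β, β')` times the diameter of `F`. Approximation by simple functions
yields joint continuity, and, carried out at a fixed `ω`, pointwise convergence in `β`. In the
ergodic case `Γ_β(φ)` is the constant `E^β(φ)`, so continuity of `Γ` gives continuity of `E`. -/

namespace BaryErgodic

noncomputable section

/-! ### Maximal ergodic inequality and Birkhoff's theorem for indicators -/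

section ErgodicAverages

variable {Ω : Type*}

/-- The average `(n+1)⁻¹ ∑_{k=0}^{n} f(T^k ω)` of an extended nonnegative function. -/
def orbitAverage (T : Ω → Ω) (f : Ω → ℝ≥0∞) (n : ℕ) (ω : Ω) : ℝ≥0∞ :=
  ((n + 1 : ℕ) : ℝ≥0∞)⁻¹ * birkhoffSum T f (n + 1) ω

/-- The upper limit of the orbit averages. -/
def upperAverage (T : Ω → Ω) (f : Ω → ℝ≥0∞) (ω : Ω) : ℝ≥0∞ :=
  limsup (fun n => orbitAverage T f n ω) atTop

/-- `max_{n ≤ N} (∑_{k<n} f(T^k ω) - n c)`, with truncated subtraction. -/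
def maximalExcess (T : Ω → Ω) (f : Ω → ℝ≥0∞) (c : ℝ≥0∞) (N : ℕ) (ω : Ω) : ℝ≥0∞ :=
  (Finset.range (N + 1)).sup fun n => birkhoffSum T f n ω - n * c

/-- A positive maximum is attained at some `n ≥ 1`; removing the first term of that sum leaves a
competitor of length `n - 1` for the maximum at `T ω`. Adding `c` on the left avoids subtraction in
the integrated form. -/
theorem maximalExcess_add_le (T : Ω → Ω) (f : Ω → ℝ≥0∞) (c : ℝ≥0∞) (N : ℕ) (ω : Ω)
    (h : 0 < maximalExcess T f c N ω) :
    maximalExcess T f c N ω + c ≤ f ω + maximalExcess T f c N (T ω) := by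
  obtain ⟨n, hn, hnN⟩ := Finset.exists_mem_eq_sup (Finset.range (N + 1)) ⟨0, by simp⟩
    fun n => birkhoffSum T f n ω - n * c
  have hF : maximalExcess T f c N ω = birkhoffSum T f n ω - n * c := hnN
  rw [hF] at h ⊢
  cases n with
  | zero => simp at h
  | succ m =>
    have hm : m ∈ Finset.range (N + 1) := by
      simp only [Finset.mem_range] at hn ⊢; omega
    have h1 : birkhoffSum T f m (T ω) - m * c ≤ maximalExcess T f c N (T ω) :=
      Finset.le_sup (f := fun n : ℕ => birkhoffSum T f n (T ω) - n * c) hm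
    rw [birkhoffSum_succ'] at h ⊢
    have h2 : ((m + 1 : ℕ) : ℝ≥0∞) * c = m * c + c := by push_cast; ring
    rw [h2, ← tsub_tsub] at h ⊢
    rw [tsub_add_cancel_of_le (tsub_pos_iff_lt.1 h).le]
    exact add_tsub_le_assoc.trans (by gcongr)

theorem birkhoffSum_mono_right (T : Ω → Ω) (f : Ω → ℝ≥0∞) {m n : ℕ} (h : m ≤ n) (ω : Ω) :
    birkhoffSum T f m ω ≤ birkhoffSum T f n ω :=
  Finset.sum_le_sum_of_subset (Finset.range_subset_range.2 h)

/-- The average of `n + 1` terms from `T ω` is at most `(n + 2)/(n + 1)` times the average of `n +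
2` terms from `ω`, and this ratio tends to 1. The one-sided bound suffices: it makes superlevel sets
contain their preimages, and preservation of a finite measure does the rest. -/
theorem upperAverage_comp_le (T : Ω → Ω) (f : Ω → ℝ≥0∞) (ω : Ω) :
    upperAverage T f (T ω) ≤ upperAverage T f ω := by
  set r : ℕ → ℝ≥0∞ := fun n => ((n + 2 : ℕ) : ℝ≥0∞) / ((n + 1 : ℕ) : ℝ≥0∞) with hr
  have hr1 : Tendsto r atTop (𝓝 1) := by
    have h1 : ∀ n : ℕ, r n = 1 + ((n + 1 : ℕ) : ℝ≥0∞)⁻¹ := fun n => by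
      change ((n + 2 : ℕ) : ℝ≥0∞) / ((n + 1 : ℕ) : ℝ≥0∞) = _
      have : ((n + 2 : ℕ) : ℝ≥0∞) = ((n + 1 : ℕ) : ℝ≥0∞) + 1 := by push_cast; ring
      rw [this, ENNReal.add_div, ENNReal.div_self (by simp) (by finiteness), one_div]
    have h2 : Tendsto (fun n : ℕ => ((n + 1 : ℕ) : ℝ≥0∞)⁻¹) atTop (𝓝 0) :=
      (tendsto_add_atTop_iff_nat 1).2 ENNReal.tendsto_inv_nat_nhds_zero
    rw [funext h1]
    simpa using (tendsto_const_nhds (x := (1 : ℝ≥0∞))).add h2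
  have hle : ∀ n, orbitAverage T f n (T ω) ≤ (r * fun n => orbitAverage T f (n + 1) ω) n := by
    intro n
    simp only [orbitAverage, Pi.mul_apply, hr]
    rw [birkhoffSum_succ' T f (n + 1), ← mul_assoc, ENNReal.div_eq_inv_mul, mul_assoc (_⁻¹),
      ENNReal.mul_inv_cancel (by simp) (by finiteness), mul_one]
    gcongr
    exact le_add_self
  have hshift : limsup (fun n => orbitAverage T f (n + 1) ω) atTop = upperAverage T f ω :=
    limsup_nat_add (fun n => orbitAverage T f n ω) 1
  calc upperAverage T f (T ω) ≤ limsup (r * fun n => orbitAverage T f (n + 1) ω) atTop :=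
        limsup_le_limsup (Eventually.of_forall hle)
    _ ≤ limsup r atTop * limsup (fun n => orbitAverage T f (n + 1) ω) atTop :=
        ENNReal.limsup_mul_le' (by simp [hr1.limsup_eq]) (by simp [hr1.limsup_eq])
    _ = upperAverage T f ω := by rw [hr1.limsup_eq, hshift, one_mul]

theorem orbitAverage_one (T : Ω → Ω) (n : ℕ) (ω : Ω) : orbitAverage T 1 n ω = 1 := by
  simp only [orbitAverage, birkhoffSum, Pi.one_apply, Finset.sum_const, Finset.card_range,
    nsmul_eq_mul, mul_one]
  exact ENNReal.inv_mul_cancel (by simp) (by finiteness)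

theorem orbitAverage_indicator_add_compl (T : Ω → Ω) (A : Set Ω) (n : ℕ) (ω : Ω) :
    orbitAverage T (A.indicator 1) n ω + orbitAverage T (Aᶜ.indicator 1) n ω = 1 := by
  rw [← orbitAverage_one T n ω]
  simp only [orbitAverage, birkhoffSum, ← mul_add, ← Finset.sum_add_distrib]
  congr! 2 with k
  exact Set.indicator_self_add_compl_apply A 1 _

theorem upperAverage_indicator_le_one (T : Ω → Ω) (A : Set Ω) (ω : Ω) :
    upperAverage T (A.indicator 1) ω ≤ 1 :=
  limsup_le_of_le (by isBoundedDefault) (Eventually.of_forall fun n =>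
    (self_le_add_right _ _).trans_eq (orbitAverage_indicator_add_compl T A n ω))

/-- The averages for `A` and `Aᶜ` sum to 1, so the lower limit for `A` is 1 minus the upper limit
for `Aᶜ`, which the hypothesis bounds below by the upper limit for `A`. -/
theorem tendsto_orbitAverage_indicator {T : Ω → Ω} {A : Set Ω} {ω : Ω}
    (h : upperAverage T (A.indicator 1) ω + upperAverage T (Aᶜ.indicator 1) ω ≤ 1) :
    Tendsto (fun n => orbitAverage T (A.indicator 1) n ω) atTop
      (𝓝 (upperAverage T (A.indicator 1) ω)) := by
  refine tendsto_of_le_liminf_of_limsup_le ?_ le_rfl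
  have hc : upperAverage T (Aᶜ.indicator 1) ω ≠ ∞ :=
    ne_top_of_le_ne_top ENNReal.one_ne_top (upperAverage_indicator_le_one _ _ _)
  have h1 : upperAverage T (A.indicator 1) ω ≤ 1 - upperAverage T (Aᶜ.indicator 1) ω :=
    ENNReal.le_sub_of_add_le_right hc h
  refine h1.trans ?_
  refine le_of_forall_lt fun a ha => ?_
  obtain ⟨b, hab, hb⟩ := exists_between ha
  refine hab.trans_le (le_liminf_of_le (by isBoundedDefault) ?_)
  have hb' : upperAverage T (Aᶜ.indicator 1) ω < 1 - b := by
    rw [lt_tsub_iff_right] at hb ⊢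
    rwa [add_comm]
  filter_upwards [eventually_lt_of_limsup_lt hb'] with n hn
  have h2 := orbitAverage_indicator_add_compl T A n ω
  by_contra! hlt
  have h3 : orbitAverage T (Aᶜ.indicator 1) n ω + b < 1 := by
    rwa [lt_tsub_iff_right] at hn
  have h4 : orbitAverage T (A.indicator 1) n ω + orbitAverage T (Aᶜ.indicator 1) n ω < 1 := by
    refine lt_of_le_of_lt ?_ h3
    rw [add_comm]
    gcongr
  exact h4.ne h2

variable [MeasurableSpace Ω] {P : Measure Ω} {T : Ω → Ω}

theorem measurable_birkhoffSum (hT : Measurable T) {f : Ω → ℝ≥0∞} (hf : Measurable f) (n : ℕ) :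
    Measurable (birkhoffSum T f n) := by
  unfold birkhoffSum
  exact Finset.measurable_sum _ fun k _ => hf.comp (hT.iterate k)

theorem measurable_orbitAverage (hT : Measurable T) {f : Ω → ℝ≥0∞} (hf : Measurable f) (n : ℕ) :
    Measurable (orbitAverage T f n) :=
  (measurable_birkhoffSum hT hf _).const_mul _

theorem measurable_upperAverage (hT : Measurable T) {f : Ω → ℝ≥0∞} (hf : Measurable f) :
    Measurable (upperAverage T f) :=
  Measurable.limsup fun n => measurable_orbitAverage hT hf n

theorem measurable_maximalExcess (hT : Measurable T) {f : Ω → ℝ≥0∞} (hf : Measurable f)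
    (c : ℝ≥0∞) (N : ℕ) : Measurable (maximalExcess T f c N) := by
  unfold maximalExcess
  simp only [Finset.sup_eq_iSup]
  exact Measurable.iSup fun n => Measurable.iSup fun _ =>
    (measurable_birkhoffSum hT hf n).sub_const _

theorem lintegral_birkhoffSum (hT : MeasurePreserving T P P) {f : Ω → ℝ≥0∞} (hf : Measurable f)
    (n : ℕ) : ∫⁻ ω, birkhoffSum T f n ω ∂P = n * ∫⁻ ω, f ω ∂P := by
  simp only [birkhoffSum]
  rw [lintegral_finsetSum (f := fun k ω => f (T^[k] ω)) _
    fun k _ => hf.comp (hT.measurable.iterate k)]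
  simp [(hT.iterate _).lintegral_comp hf]

theorem lintegral_orbitAverage (hT : MeasurePreserving T P P) {f : Ω → ℝ≥0∞} (hf : Measurable f)
    (n : ℕ) : ∫⁻ ω, orbitAverage T f n ω ∂P = ∫⁻ ω, f ω ∂P := by
  simp only [orbitAverage]
  rw [lintegral_const_mul _ (measurable_birkhoffSum hT.measurable hf _),
    lintegral_birkhoffSum hT hf, ← mul_assoc, ENNReal.inv_mul_cancel (by simp) (by finiteness),
    one_mul]

/-- The maximal ergodic inequality. -/
theorem mul_measure_maximalExcess_pos_le (hT : MeasurePreserving T P P) {f : Ω → ℝ≥0∞}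
    (hf : Measurable f) (c : ℝ≥0∞) (N : ℕ) :
    c * P {ω | 0 < maximalExcess T f c N ω} ≤ ∫⁻ ω, f ω ∂P := by
  rcases eq_or_ne (∫⁻ ω, f ω ∂P) ∞ with hfin | hfin
  · simp [hfin]
  set F := maximalExcess T f c N
  have hF : Measurable F := measurable_maximalExcess hT.measurable hf c N
  have hE : MeasurableSet {ω | 0 < F ω} := measurableSet_lt measurable_const hF
  have hFfin : ∫⁻ ω, F ω ∂P ≠ ∞ := by
    refine ne_top_of_le_ne_top (b := ∫⁻ ω, birkhoffSum T f N ω ∂P) ?_ (lintegral_mono fun ω => ?_)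
    · rw [lintegral_birkhoffSum hT hf]; finiteness
    · refine Finset.sup_le fun n hn => tsub_le_self.trans (birkhoffSum_mono_right T f ?_ ω)
      simp only [Finset.mem_range] at hn; omega
  have key : ∀ ω, F ω + {ω | 0 < F ω}.indicator (fun _ => c) ω ≤ f ω + F (T ω) := by
    intro ω
    by_cases h : 0 < F ω
    · simpa [h] using maximalExcess_add_le T f c N ω h
    · have h0 : F ω = 0 := by simpa using h
      simp [h0]
  -- Both `F` and `F ∘ T` have the same integral, which is finite and hence cancels.
  have h := lintegral_mono (μ := P) key
  rw [lintegral_add_left hF, lintegral_indicator hE, lintegral_const, lintegral_add_left hf,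
    hT.lintegral_comp hF, add_comm, Measure.restrict_apply_univ] at h
  exact (ENNReal.add_le_add_iff_right hFfin).1 h

theorem mul_measure_lt_upperAverage_le (hT : MeasurePreserving T P P) {f : Ω → ℝ≥0∞}
    (hf : Measurable f) (c : ℝ≥0∞) :
    c * P {ω | c < upperAverage T f ω} ≤ ∫⁻ ω, f ω ∂P := by
  have hsub : {ω | c < upperAverage T f ω} ⊆ ⋃ N, {ω | 0 < maximalExcess T f c N ω} := by
    intro ω hω
    obtain ⟨n, hn⟩ := (frequently_lt_of_lt_limsup (f := atTop)
      (u := fun n => orbitAverage T f n ω) (by isBoundedDefault) hω).exists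
    refine Set.mem_iUnion.2 ⟨n + 1, ?_⟩
    have h1 : 0 < birkhoffSum T f (n + 1) ω - (n + 1 : ℕ) * c := by
      rw [tsub_pos_iff_lt, mul_comm]
      rw [orbitAverage, ← ENNReal.div_eq_inv_mul] at hn
      exact (ENNReal.lt_div_iff_mul_lt (by simp) (by simp)).1 hn
    exact h1.trans_le (Finset.le_sup (f := fun n : ℕ => birkhoffSum T f n ω - n * c)
      (Finset.self_mem_range_succ _))
  have hmono : Monotone fun N => {ω | 0 < maximalExcess T f c N ω} := by
    intro N N' h ω hω
    exact (show 0 < maximalExcess T f c N ω from hω).trans_le (Finset.sup_mono (Finset.range_subset_range.2 (by omega)))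
  refine (mul_le_mul_right (measure_mono hsub) c).trans ?_
  rw [hmono.measure_iUnion, ENNReal.mul_iSup]
  exact iSup_le fun N => mul_measure_maximalExcess_pos_le hT hf c N

/-- Almost every orbit starting in `E` stays in `E`, so there `f` and `E.indicator f` have the same
orbit averages; the global inequality is applied to the latter. -/
theorem mul_measure_inter_lt_upperAverage_le (hT : MeasurePreserving T P P) {f : Ω → ℝ≥0∞}
    (hf : Measurable f) (c : ℝ≥0∞) {E : Set Ω} (hE : MeasurableSet E) (hTE : T ⁻¹' E =ᵐ[P] E) :
    c * P (E ∩ {ω | c < upperAverage T f ω}) ≤ ∫⁻ ω in E, f ω ∂P := by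
  have h1 : ∀ᵐ ω ∂P, ∀ k, T^[k] ω ∈ E ↔ ω ∈ E := by
    refine ae_all_iff.2 fun k => ?_
    have := hT.quasiMeasurePreserving.preimage_iterate_ae_eq k hTE
    filter_upwards [this] with ω hω
    exact iff_of_eq hω
  have h2 : ∀ᵐ ω ∂P, ω ∈ E ∩ {ω | c < upperAverage T f ω} →
      ω ∈ {ω | c < upperAverage T (E.indicator f) ω} := by
    filter_upwards [h1] with ω hω ⟨hωE, hωc⟩
    have : upperAverage T (E.indicator f) ω = upperAverage T f ω := by
      simp only [upperAverage, orbitAverage, birkhoffSum]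
      simp only [Set.indicator_of_mem ((hω _).2 hωE) f]
    simpa [this] using hωc
  refine (mul_le_mul_right (measure_mono_ae h2) c).trans ?_
  rw [← lintegral_indicator hE]
  exact mul_measure_lt_upperAverage_le hT (hf.indicator hE) c

/-- If the two upper averages exceed `b` and `b'` on `E`, with `b + b' > 1`, then `E` is invariant
mod `P`, and the localized maximal inequality gives `(b + b') P(E) ≤ P(A ∩ E) + P(Aᶜ ∩ E) = P(E)`,
so `E` is null. -/
theorem upperAverage_indicator_add_compl_le [IsProbabilityMeasure P]
    (hT : MeasurePreserving T P P) {A : Set Ω} (hA : MeasurableSet A) :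
    ∀ᵐ ω ∂P, upperAverage T (A.indicator 1) ω + upperAverage T (Aᶜ.indicator 1) ω ≤ 1 := by
  have hm : ∀ {B : Set Ω}, MeasurableSet B → Measurable (upperAverage T (B.indicator 1)) :=
    fun hB => measurable_upperAverage hT.measurable (measurable_one.indicator hB)
  have key : ∀ b b' : ℝ≥0∞, 1 < b + b' →
      ∀ᵐ ω ∂P, ¬ (b < upperAverage T (A.indicator 1) ω ∧ b' < upperAverage T (Aᶜ.indicator 1) ω) := by
    intro b b' hb
    set E := {ω | b < upperAverage T (A.indicator 1) ω ∧ b' < upperAverage T (Aᶜ.indicator 1) ω}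
      with hEdef
    have hE : MeasurableSet E := (measurableSet_lt measurable_const (hm hA)).inter
      (measurableSet_lt measurable_const (hm hA.compl))
    have hTE : T ⁻¹' E =ᵐ[P] E := by
      refine ae_eq_of_subset_of_measure_ge ?_ ?_ (hT.measurable hE).nullMeasurableSet (by finiteness)
      · exact fun ω hω => ⟨hω.1.trans_le (upperAverage_comp_le T _ ω),
          hω.2.trans_le (upperAverage_comp_le T _ ω)⟩
      · rw [hT.measure_preimage hE.nullMeasurableSet]
    have h1 := mul_measure_inter_lt_upperAverage_le hT (measurable_one.indicator hA) b hE hTE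
    have h2 := mul_measure_inter_lt_upperAverage_le hT (measurable_one.indicator hA.compl) b' hE hTE
    rw [Set.inter_eq_left.2 fun ω hω => hω.1] at h1
    rw [Set.inter_eq_left.2 fun ω hω => hω.2] at h2
    have h3 : (b + b') * P E ≤ P E := by
      rw [add_mul]
      refine (add_le_add h1 h2).trans_eq ?_
      rw [lintegral_indicator_one hA, lintegral_indicator_one hA.compl, measure_add_measure_compl hA,
        Measure.restrict_apply_univ]
    by_contra hne
    have hpos : P E ≠ 0 := by
      rwa [ae_iff, show {ω | ¬ ¬ (b < upperAverage T (A.indicator 1) ω ∧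
        b' < upperAverage T (Aᶜ.indicator 1) ω)} = E by simp [hEdef]] at hne
    have : 1 * P E < (b + b') * P E := ENNReal.mul_lt_mul_left hpos (by finiteness) hb
    rw [one_mul] at this
    exact absurd h3 (not_le.2 this)
  have hall : ∀ᵐ ω ∂P, ∀ q q' : ℚ, 1 < ((q : ℝ).toNNReal : ℝ≥0∞) + ((q' : ℝ).toNNReal : ℝ≥0∞) →
      ¬ (((q : ℝ).toNNReal : ℝ≥0∞) < upperAverage T (A.indicator 1) ω ∧
        ((q' : ℝ).toNNReal : ℝ≥0∞) < upperAverage T (Aᶜ.indicator 1) ω) := by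
    refine ae_all_iff.2 fun q => ae_all_iff.2 fun q' => ?_
    by_cases h : 1 < ((q : ℝ).toNNReal : ℝ≥0∞) + ((q' : ℝ).toNNReal : ℝ≥0∞)
    · filter_upwards [key _ _ h] with ω hω _ using hω
    · exact Eventually.of_forall fun ω h' => absurd h' h
  filter_upwards [hall] with ω hω
  by_contra! hlt
  have hx1 := upperAverage_indicator_le_one T A ω
  have hy1 := upperAverage_indicator_le_one T Aᶜ ω
  set x := upperAverage T (A.indicator 1) ω
  set y := upperAverage T (Aᶜ.indicator 1) ω
  have hx : x ≠ ∞ := ne_top_of_le_ne_top ENNReal.one_ne_top hx1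
  have hy : y ≠ ∞ := ne_top_of_le_ne_top ENNReal.one_ne_top hy1
  -- Pick `q` between `1 - y` and `x`, then `q'` between `1 - q` and `y`; thus `q + q' > 1`.
  obtain ⟨q, -, hq1, hq2⟩ := ENNReal.lt_iff_exists_rat_btwn.1
    (ENNReal.sub_lt_of_lt_add hy1 hlt)
  have h2 : 1 < ((q : ℝ).toNNReal : ℝ≥0∞) + y := by
    rwa [ENNReal.sub_lt_iff_lt_right hy hy1] at hq1
  have hq1' : ((q : ℝ).toNNReal : ℝ≥0∞) ≤ 1 := hq2.le.trans hx1
  obtain ⟨q', -, hq1'', hq2'⟩ := ENNReal.lt_iff_exists_rat_btwn.1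
    (ENNReal.sub_lt_of_lt_add hq1' (by rwa [add_comm] at h2))
  refine hω q q' ?_ ⟨hq2, hq2'⟩
  rwa [ENNReal.sub_lt_iff_lt_left (by finiteness) hq1'] at hq1''

/-- Birkhoff's theorem for the visits to a measurable set. The limit agrees along the orbits of
`ω` and of `T ω`. -/
theorem ae_tendsto_orbitAverage_indicator [IsProbabilityMeasure P]
    (hT : MeasurePreserving T P P) {A : Set Ω} (hA : MeasurableSet A) :
    ∀ᵐ ω ∂P, Tendsto (fun n => orbitAverage T (A.indicator 1) n ω) atTop
        (𝓝 (upperAverage T (A.indicator 1) ω)) ∧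
      Tendsto (fun n => orbitAverage T (A.indicator 1) n (T ω)) atTop
        (𝓝 (upperAverage T (A.indicator 1) ω)) := by
  have h := upperAverage_indicator_add_compl_le hT hA
  filter_upwards [h, hT.quasiMeasurePreserving.ae h] with ω h1 h2
  refine ⟨tendsto_orbitAverage_indicator h1, ?_⟩
  have t1 := tendsto_orbitAverage_indicator h2
  have t2 := tendsto_orbitAverage_indicator (T := T) (ω := T ω) (A := Aᶜ)
    (by rwa [compl_compl, add_comm])
  have h3 : upperAverage T (A.indicator 1) (T ω) + upperAverage T (Aᶜ.indicator 1) (T ω) = 1 := by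
    refine tendsto_nhds_unique (t1.add t2) ?_
    simp only [orbitAverage_indicator_add_compl]
    exact tendsto_const_nhds
  -- The sum of the two upper averages is 1 at `T ω` and at most 1 at `ω`, while each one can only
  -- grow from `T ω` to `ω`; so neither does.
  have h4 : upperAverage T (A.indicator 1) (T ω) = upperAverage T (A.indicator 1) ω := by
    refine le_antisymm (upperAverage_comp_le T _ ω) ?_
    have hfin : upperAverage T (Aᶜ.indicator 1) (T ω) ≠ ∞ :=
      ne_top_of_le_ne_top ENNReal.one_ne_top (upperAverage_indicator_le_one _ _ _)
    refine (ENNReal.add_le_add_iff_right hfin).1 ?_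
    rw [h3]
    exact (add_le_add le_rfl (upperAverage_comp_le T _ ω)).trans h1
  rwa [h4] at t1

/-- The limit is invariant, hence a.e. constant; dominated convergence identifies the constant,
every orbit average having integral `P A`. -/
theorem ae_upperAverage_indicator_eq_of_ergodic [IsProbabilityMeasure P] (hT : Ergodic T P)
    {A : Set Ω} (hA : MeasurableSet A) :
    ∀ᵐ ω ∂P, upperAverage T (A.indicator 1) ω = P A := by
  have hmp := hT.toMeasurePreserving
  have h := ae_tendsto_orbitAverage_indicator hmp hA
  have hind : Measurable (A.indicator (1 : Ω → ℝ≥0∞)) := measurable_one.indicator hA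
  have hm := measurable_upperAverage hmp.measurable hind
  have hinv : upperAverage T (A.indicator 1) ∘ T =ᵐ[P] upperAverage T (A.indicator 1) := by
    filter_upwards [h, hmp.quasiMeasurePreserving.ae h] with ω h1 h2
    exact tendsto_nhds_unique h2.1 h1.2
  obtain ⟨c, hc⟩ := hT.ae_eq_const_of_ae_eq_comp₀ hm.nullMeasurable hinv
  have hlim : Tendsto (fun n => ∫⁻ ω, orbitAverage T (A.indicator 1) n ω ∂P) atTop
      (𝓝 (∫⁻ ω, upperAverage T (A.indicator 1) ω ∂P)) := by
    refine tendsto_lintegral_of_dominated_convergence (fun _ => 1)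
      (fun n => measurable_orbitAverage hmp.measurable hind n)
      (fun n => Eventually.of_forall fun ω => ?_) (by simp) (h.mono fun ω hω => hω.1)
    exact (self_le_add_right _ _).trans_eq (orbitAverage_indicator_add_compl T A n ω)
  simp only [lintegral_orbitAverage hmp hind, lintegral_indicator_one hA] at hlim
  have hPA : P A = c := by
    rw [tendsto_nhds_unique tendsto_const_nhds hlim, lintegral_congr_ae hc]
    simp
  filter_upwards [hc] with ω hω
  rw [hPA, hω]; rfl

theorem ae_forall_iterate_mem (hT : MeasurePreserving T P P) {α : Type*} {f : Ω → α}
    {F : Finset α} (hF : ∀ᵐ ω ∂P, f ω ∈ F) : ∀ᵐ ω ∂P, ∀ k, f (T^[k] ω) ∈ F :=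
  ae_all_iff.2 fun k => (hT.iterate k).quasiMeasurePreserving.ae hF

end ErgodicAverages

/-! ### Transport between finite weight vectors -/

section Transport

/-- The shared mass `min (a i) (b i)` stays in place at no cost; each surplus `a i - b i` is spread
over the deficits `b j - a j` in proportion to their size. -/
theorem exists_transport_plan {ι : Type*} [Fintype ι] [DecidableEq ι] (a b : ι → ℝ≥0∞)
    (hab : ∑ i, a i = ∑ i, b i) (ha : ∑ i, a i ≠ ∞) :
    ∃ w : ι → ι → ℝ≥0∞, (∀ i, ∑ j, w i j = a i) ∧ (∀ j, ∑ i, w i j = b j) ∧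
      ∀ (C : ι → ι → ℝ≥0∞) (K : ℝ≥0∞), (∀ i, C i i = 0) → (∀ i j, C i j ≤ K) →
        ∑ i, ∑ j, w i j * C i j ≤ K * ∑ i, (a i - b i) := by
  set t := ∑ i, (a i - b i) with ht
  have hsub : ∀ x y : ℝ≥0∞, (x - y) + min x y = x := fun x y => by
    rcases le_total x y with h | h
    · simp [h, tsub_eq_zero_of_le h]
    · rw [min_eq_right h, tsub_add_cancel_of_le h]
  have hmin : ∑ i, min (a i) (b i) ≠ ∞ :=
    ne_top_of_le_ne_top ha (Finset.sum_le_sum fun i _ => min_le_left _ _)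
  have htop : t ≠ ∞ := ne_top_of_le_ne_top ha (Finset.sum_le_sum fun i _ => tsub_le_self)
  have ht' : ∑ i, (b i - a i) = t := by
    refine (ENNReal.add_left_inj hmin).1 ?_
    rw [ht, ← Finset.sum_add_distrib, ← Finset.sum_add_distrib]
    simp only [hsub]
    simp only [min_comm (a _), hsub]
    exact hab.symm
  -- If `t = 0` then `t⁻¹ = ∞`, but `∞ * 0 = 0` and `x = 0`, so no case split is needed in the plan.
  have hscale : ∀ x, x ≤ t → x * (t⁻¹ * t) = x := fun x hx => by
    rcases eq_or_ne t 0 with h0 | h0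
    · rw [h0, nonpos_iff_eq_zero] at hx; simp [hx]
    · rw [ENNReal.inv_mul_cancel h0 htop, mul_one]
  have hle : ∀ i, a i - b i ≤ t := fun i =>
    Finset.single_le_sum (f := fun i => a i - b i) (fun _ _ => zero_le) (Finset.mem_univ i)
  have hle' : ∀ i, b i - a i ≤ t := fun i => ht' ▸
    Finset.single_le_sum (f := fun i => b i - a i) (fun _ _ => zero_le) (Finset.mem_univ i)
  refine ⟨fun i j => (if i = j then min (a i) (b i) else 0) + (a i - b i) * (t⁻¹ * (b j - a j)),
    fun i => ?_, fun j => ?_, fun C K hC hK => ?_⟩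
  · rw [Finset.sum_add_distrib, ← Finset.mul_sum, ← Finset.mul_sum, ht', hscale _ (hle i)]
    simp only [Finset.sum_ite_eq, Finset.mem_univ, if_true]
    rw [add_comm, hsub]
  · rw [Finset.sum_add_distrib, ← Finset.sum_mul, ← ht, ← mul_assoc, mul_comm _ (b j - a j),
      mul_comm t, hscale _ (hle' j)]
    simp only [Finset.sum_ite_eq', Finset.mem_univ, if_true]
    rw [add_comm, min_comm, hsub]
  · calc _ ≤ ∑ i, ∑ j, (a i - b i) * (t⁻¹ * (b j - a j)) * K := by
          refine Finset.sum_le_sum fun i _ => Finset.sum_le_sum fun j _ => ?_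
          rcases eq_or_ne i j with rfl | h
          · simp [hC]
          · simp only [h, if_false, zero_add]
            gcongr
            exact hK i j
      _ = K * t := by
          simp only [← Finset.sum_mul, ← Finset.mul_sum]
          rw [ht', ← ht, hscale t le_rfl, mul_comm]

end Transport

/-! ### Upper bounds for the Wasserstein distance -/

section Wasserstein

variable {M : Type*} [MetricSpace M] [MeasurableSpace M] {p : ℝ}

theorem wasserstein_le_of_isCoupling (hp : 0 ≤ p) {μ ν : Measure M} {π : Measure (M × M)}
    (h : IsCoupling π μ ν) :
    wasserstein p μ ν ≤ (∫⁻ z, edist z.1 z.2 ^ p ∂π) ^ (1 / p) :=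
  ENNReal.rpow_le_rpow (iInf_le_of_le ⟨π, h⟩ le_rfl) (by positivity)

theorem wasserstein_map_le (hp : 0 ≤ p) {Ω : Type*} [MeasurableSpace Ω] (P : Measure Ω)
    {f g : Ω → M} (hf : Measurable f) (hg : Measurable g) :
    wasserstein p (P.map f) (P.map g) ≤ (∫⁻ ω, edist (f ω) (g ω) ^ p ∂P) ^ (1 / p) := by
  have h : IsCoupling (P.map fun ω => (f ω, g ω)) (P.map f) (P.map g) :=
    ⟨by rw [Measure.map_map measurable_fst (hf.prodMk hg)]; rfl,
      by rw [Measure.map_map measurable_snd (hf.prodMk hg)]; rfl⟩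
  -- `lintegral_map_le` needs no measurability of the cost, which may fail for the product
  -- `σ`-algebra when `M` is not separable.
  exact (wasserstein_le_of_isCoupling hp h).trans
    (ENNReal.rpow_le_rpow (lintegral_map_le _ _) (by positivity))

variable [BorelSpace M]

theorem wasserstein_sum_dirac_le (hp : 0 ≤ p) {κ : Type*} [Fintype κ] (w : κ → ℝ≥0∞)
    (x y : κ → M) :
    wasserstein p (∑ k, w k • Measure.dirac (x k)) (∑ k, w k • Measure.dirac (y k)) ≤
      (∑ k, w k * edist (x k) (y k) ^ p) ^ (1 / p) := by
  have h : IsCoupling (∑ k, w k • Measure.dirac (x k, y k)) (∑ k, w k • Measure.dirac (x k))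
      (∑ k, w k • Measure.dirac (y k)) := by
    constructor
    · ext s hs
      rw [Measure.map_apply measurable_fst hs]
      simp [Measure.coe_finsetSum, Measure.dirac_apply' _ hs,
        Measure.dirac_apply' _ (measurable_fst hs)]
      rfl
    · ext s hs
      rw [Measure.map_apply measurable_snd hs]
      simp [Measure.coe_finsetSum, Measure.dirac_apply' _ hs,
        Measure.dirac_apply' _ (measurable_snd hs)]
      rfl
  refine (wasserstein_le_of_isCoupling hp h).trans_eq ?_
  simp [lintegral_finsetSum_measure, lintegral_smul_measure]

theorem wasserstein_tupleMeasure_le (hp : 0 ≤ p) {n : ℕ} (x y : Fin n → M) :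
    wasserstein p (tupleMeasure x) (tupleMeasure y) ≤
      ((n : ℝ≥0∞)⁻¹ * ∑ j, edist (x j) (y j) ^ p) ^ (1 / p) := by
  have := wasserstein_sum_dirac_le hp (fun _ : Fin n => (n : ℝ≥0∞)⁻¹) x y
  simpa only [tupleMeasure, Finset.smul_sum, Finset.mul_sum] using this

theorem eq_sum_smul_dirac (μ : Measure M) (F : Finset M) (h : μ (F : Set M)ᶜ = 0) :
    μ = ∑ a : F, μ {(a : M)} • Measure.dirac (a : M) := by
  classical
  ext s hs
  have h1 : μ s = μ (s ∩ F) := by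
    refine (measure_inter_conull' ?_).symm
    exact measure_mono_null (fun x hx => hx.2) h
  have h2 : s ∩ F = ((F.filter (· ∈ s) : Finset M) : Set M) := by ext; simp [and_comm]
  rw [h1, h2, ← sum_measure_singleton, Finset.sum_filter]
  simp only [Measure.coe_finsetSum, Finset.sum_apply, Measure.smul_apply, smul_eq_mul,
    Measure.dirac_apply' _ hs]
  rw [Finset.univ_eq_attach, F.sum_attach fun a => μ {a} * s.indicator 1 a]
  refine Finset.sum_congr rfl fun a _ => ?_
  by_cases ha : a ∈ s <;> simp [ha]

theorem wasserstein_le_of_finset (hp : 0 < p) (F : Finset M) (μ ν : Measure M)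
    [IsProbabilityMeasure μ] [IsProbabilityMeasure ν] (hμ : μ (F : Set M)ᶜ = 0)
    (hν : ν (F : Set M)ᶜ = 0) :
    wasserstein p μ ν ≤
      (Metric.ediam (F : Set M) ^ p * ∑ a : F, (μ {(a : M)} - ν {(a : M)})) ^ (1 / p) := by
  classical
  have htot : ∀ (ρ : Measure M) [IsProbabilityMeasure ρ], ρ (F : Set M)ᶜ = 0 →
      ∑ a : F, ρ {(a : M)} = 1 := by
    intro ρ _ hρ
    have := congrArg (fun m : Measure M => m Set.univ) (eq_sum_smul_dirac ρ F hρ)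
    simpa [Measure.coe_finsetSum] using this.symm
  obtain ⟨w, hw1, hw2, hw⟩ := exists_transport_plan (fun a : F => μ {(a : M)})
    (fun a : F => ν {(a : M)}) ((htot μ hμ).trans (htot ν hν).symm) (by rw [htot μ hμ]; simp)
  have h := wasserstein_sum_dirac_le hp.le (fun k : F × F => w k.1 k.2) (fun k => (k.1 : M))
    (fun k => (k.2 : M))
  have e1 : ∑ k : F × F, w k.1 k.2 • Measure.dirac (k.1 : M) = μ := by
    rw [Fintype.sum_prod_type]
    simp only [← Finset.sum_smul, hw1]
    exact (eq_sum_smul_dirac μ F hμ).symm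
  have e2 : ∑ k : F × F, w k.1 k.2 • Measure.dirac (k.2 : M) = ν := by
    rw [Fintype.sum_prod_type_right]
    simp only [← Finset.sum_smul, hw2]
    exact (eq_sum_smul_dirac ν F hν).symm
  rw [e1, e2] at h
  refine h.trans (ENNReal.rpow_le_rpow ?_ (by positivity))
  rw [Fintype.sum_prod_type]
  refine hw (fun i j => edist (i : M) (j : M) ^ p) _ (fun i => by simp [hp]) fun i j => ?_
  exact ENNReal.rpow_le_rpow (Metric.edist_le_ediam_of_mem i.2 j.2) hp.le

end Wasserstein

/-! ### Contractivity and the metric on barycentric maps -/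

section Barycenters

variable {M : Type*} [MetricSpace M] [MeasurableSpace M] [BorelSpace M] {p : ℝ} [hp : Fact (1 ≤ p)]

theorem edist_tupleP_le (β : BaryMap M p) {n : ℕ} (x y : Fin (n + 1) → M) :
    edist (β (tupleP p x)) (β (tupleP p y)) ≤
      (((n + 1 : ℕ) : ℝ≥0∞)⁻¹ * ∑ j, edist (x j) (y j) ^ p) ^ (1 / p) :=
  (β.contractive _ _).trans (wasserstein_tupleMeasure_le (zero_le_one.trans hp.out) x y)

theorem continuous_tupleP (β : BaryMap M p) (n : ℕ) :
    Continuous fun x : Fin (n + 1) → M => β (tupleP p x) := by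
  have hp0 : 0 < p := zero_lt_one.trans_le hp.out
  refine LipschitzWith.continuous (K := 1) fun x y => (edist_tupleP_le β x y).trans ?_
  rw [ENNReal.coe_one, one_mul, one_div, ENNReal.rpow_inv_le_iff hp0]
  calc _ ≤ ((n + 1 : ℕ) : ℝ≥0∞)⁻¹ * ∑ _j : Fin (n + 1), edist x y ^ p := by
        gcongr with j
        exact edist_le_pi_edist x y j
    _ = edist x y ^ p := by
        rw [Finset.sum_const, Finset.card_univ, Fintype.card_fin, nsmul_eq_mul, ← mul_assoc,
          ENNReal.inv_mul_cancel (by simp) (by finiteness), one_mul]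

theorem tupleP_const (n : ℕ) (x : M) : tupleP p (fun _ : Fin (n + 1) => x) = diracP p x := by
  refine Subtype.ext ?_
  simp only [tupleP, diracP, tupleMeasure, Finset.sum_const, Finset.card_univ, Fintype.card_fin]
  rw [← Nat.cast_smul_eq_nsmul ℝ≥0∞, smul_smul, ENNReal.inv_mul_cancel (by simp) (by finiteness),
    one_smul]

theorem edist_tupleP_le_mul_ediam (β β' : BaryMap M p) {n : ℕ} (x : Fin (n + 1) → M) :
    edist (β (tupleP p x)) (β' (tupleP p x)) ≤ edist β β' * Metric.ediam (Set.range x) := by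
  rcases eq_or_ne (Metric.ediam (Set.range x)) 0 with h | h
  -- Tuples of zero diameter are excluded from the supremum; they are constant, and all barycentric
  -- maps agree on Dirac measures.
  · have hx : x = fun _ => x 0 := by
      ext j
      exact Metric.ediam_eq_zero_iff.1 h ⟨j, rfl⟩ ⟨0, rfl⟩
    rw [hx, tupleP_const, β.map_dirac, β'.map_dirac]
    simp
  · have hfin : Metric.ediam (Set.range x) ≠ ∞ :=
      (Set.finite_range x).isBounded.ediam_ne_top
    rw [← ENNReal.div_le_iff h hfin]
    exact le_iSup_of_le n (le_iSup_of_le x (le_iSup_of_le h le_rfl))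

/-- Common limits of the masses leave vanishing mass to move. Two families over an arbitrary filter
cover three uses: the Cauchy property, comparison of the orbits of `ω` and `T ω`, and comparison
with the law of `f`. -/
theorem tendsto_edist_of_tendsto_measure_singleton (β : BaryMap M p) {κ : Type*} {l : Filter κ}
    (F : Finset M) {μ ν : κ → PMeas M p} (hμ : ∀ k, (μ k).1 (F : Set M)ᶜ = 0)
    (hν : ∀ k, (ν k).1 (F : Set M)ᶜ = 0) {L : M → ℝ≥0∞}
    (hμL : ∀ a ∈ F, Tendsto (fun k => (μ k).1 {a}) l (𝓝 (L a)))
    (hνL : ∀ a ∈ F, Tendsto (fun k => (ν k).1 {a}) l (𝓝 (L a))) :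
    Tendsto (fun k => edist (β (μ k)) (β (ν k))) l (𝓝 0) := by
  have hp0 : 0 < p := zero_lt_one.trans_le hp.out
  rcases l.eq_or_neBot with rfl | hl
  · exact tendsto_bot
  have hL : ∀ a ∈ F, L a ≠ ∞ := fun a ha => by
    refine ne_top_of_le_ne_top ENNReal.one_ne_top (le_of_tendsto (hμL a ha) ?_)
    refine Eventually.of_forall fun k => ?_
    have := (μ k).2.isProbabilityMeasure
    exact prob_le_one
  have hsum : Tendsto (fun k => ∑ a : F, ((μ k).1 {(a : M)} - (ν k).1 {(a : M)})) l (𝓝 0) := by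
    have := tendsto_finsetSum (Finset.univ : Finset F) fun a _ =>
      ENNReal.Tendsto.sub (hμL a a.2) (hνL a a.2) (.inl (hL a a.2))
    simpa using this
  have hD : Metric.ediam (F : Set M) ^ p ≠ ∞ :=
    ENNReal.rpow_ne_top_of_nonneg hp0.le F.finite_toSet.isBounded.ediam_ne_top
  have hlim := (ENNReal.Tendsto.const_mul hsum (.inr hD)).ennrpow_const (1 / p)
  rw [mul_zero, ENNReal.zero_rpow_of_pos (by positivity)] at hlim
  refine tendsto_of_tendsto_of_tendsto_of_le_of_le tendsto_const_nhds hlim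
    (fun _ => zero_le) fun k => ?_
  have := (μ k).2.isProbabilityMeasure
  have := (ν k).2.isProbabilityMeasure
  exact (β.contractive _ _).trans (wasserstein_le_of_finset hp0 F _ _ (hμ k) (hν k))

end Barycenters

/-! ### Strong measurability and density of finitely valued maps -/

section Density

/-- Simple approximants are combined coordinatewise, so no second countability of `M` is required.
-/
theorem stronglyMeasurable_finite_pi {Ω ι M : Type*} [MeasurableSpace Ω] [Finite ι]
    [TopologicalSpace M] {f : Ω → ι → M} (hf : ∀ i, StronglyMeasurable fun ω => f ω i) :
    StronglyMeasurable f := by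
  refine ⟨fun n => ⟨fun ω i => (hf i).approx n ω, fun y => ?_, ?_⟩, fun ω => ?_⟩
  · have : (fun ω i => (hf i).approx n ω) ⁻¹' {y} = ⋂ i, (hf i).approx n ⁻¹' {y i} := by
      ext ω; simp [funext_iff]
    rw [this]
    exact MeasurableSet.iInter fun i => ((hf i).approx n).measurableSet_fiber _
  · refine (Set.Finite.pi' fun i => ((hf i).approx n).finite_range).subset ?_
    rintro _ ⟨ω, rfl⟩ i
    exact ⟨ω, rfl⟩
  · exact tendsto_pi_nhds.2 fun i => (hf i).tendsto_approx ω

variable {Ω M : Type*} [MeasurableSpace Ω] [MetricSpace M] {p : ℝ} {P : Measure Ω}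

theorem LpMap.stronglyMeasurable (f : LpMap M p P) : StronglyMeasurable f :=
  f.1.stronglyMeasurable

theorem LpMap.measurable_edist (f g : LpMap M p P) : Measurable fun ω => edist (f ω) (g ω) :=
  (continuous_edist.comp_stronglyMeasurable
    (f.stronglyMeasurable.prodMk g.stronglyMeasurable)).measurable

/-- The class of a strongly measurable map with finite moment. -/
def LpMap.ofFun (f : Ω → M) (hf : AEStronglyMeasurable f P) (x : M)
    (hx : ∫⁻ ω, edist x (f ω) ^ p ∂P < ∞) : LpMap M p P :=
  ⟨AEEqFun.mk f hf, x, by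
    refine lt_of_eq_of_lt (lintegral_congr_ae ?_) hx
    filter_upwards [AEEqFun.coeFn_mk f hf] with ω hω
    rw [hω]⟩

theorem LpMap.coeFn_ofFun (f : Ω → M) (hf : AEStronglyMeasurable f P) (x : M)
    (hx : ∫⁻ ω, edist x (f ω) ^ p ∂P < ∞) : LpMap.ofFun f hf x hx =ᵐ[P] f :=
  AEEqFun.coeFn_mk f hf

theorem LpMap.edist_def [Fact (1 ≤ p)] (f g : LpMap M p P) :
    edist f g = (∫⁻ ω, edist (f ω) (g ω) ^ p ∂P) ^ (1 / p) := rfl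

theorem LpMap.edist_rpow [hp : Fact (1 ≤ p)] (f g : LpMap M p P) :
    edist f g ^ p = ∫⁻ ω, edist (f ω) (g ω) ^ p ∂P := by
  have hp0 : p ≠ 0 := (zero_lt_one.trans_le hp.out).ne'
  rw [LpMap.edist_def, one_div, ENNReal.rpow_inv_rpow hp0]

theorem lintegral_edist_const_rpow [IsProbabilityMeasure P] [hp : Fact (1 ≤ p)] (x y : M) :
    (∫⁻ _, edist x y ^ p ∂P) ^ (1 / p) = edist x y := by
  have hp0 : p ≠ 0 := (zero_lt_one.trans_le hp.out).ne'
  simp [ENNReal.rpow_rpow_inv hp0]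

/-- Almost every value of `f` lies in a fixed finite set. -/
def LpMap.IsFinitelyValued (f : LpMap M p P) : Prop :=
  ∃ F : Finset M, ∀ᵐ ω ∂P, f ω ∈ F

theorem LpMap.exists_isFinitelyValued_tendsto [hp : Fact (1 ≤ p)] [MeasurableSpace M]
    [BorelSpace M] (f : LpMap M p P) :
    ∃ S : ℕ → LpMap M p P, (∀ m, (S m).IsFinitelyValued) ∧
      Tendsto (fun m => edist f (S m)) atTop (𝓝 0) := by
  have hp0 : 0 < p := zero_lt_one.trans_le hp.out
  obtain ⟨x, hx⟩ := f.2
  have hfm : Measurable (f : Ω → M) := f.stronglyMeasurable.measurable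
  -- With `x` as base point, the approximation error is dominated by `edist x (f ω)`, whose `p`-th
  -- power is integrable.
  set A : Set M := Set.range f ∪ {x}
  have hA : TopologicalSpace.IsSeparable A :=
    f.stronglyMeasurable.isSeparable_range.union (Set.finite_singleton x).isSeparable
  have : TopologicalSpace.SeparableSpace A := hA.separableSpace
  have hxA : x ∈ A := Or.inr rfl
  set s : ℕ → SimpleFunc Ω M := SimpleFunc.approxOn f hfm A x hxA with hs
  have hint : ∀ m, ∫⁻ ω, edist x (s m ω) ^ p ∂P < ∞ := fun m => by
    refine lt_of_le_of_lt (lintegral_mono fun ω => ENNReal.rpow_le_rpow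
      (SimpleFunc.edist_approxOn_y0_le hfm hxA ω m) hp0.le) ?_
    refine lt_of_le_of_lt (lintegral_mono fun ω =>
      ENNReal.rpow_add_le_mul_rpow_add_rpow _ _ hp.out) ?_
    rw [lintegral_const_mul' _ _ (by finiteness), lintegral_add_left (by fun_prop)]
    finiteness
  refine ⟨fun m => LpMap.ofFun (s m) (s m).stronglyMeasurable.aestronglyMeasurable x (hint m),
    fun m => ⟨(s m).range, ?_⟩, ?_⟩
  · filter_upwards [LpMap.coeFn_ofFun (s m) (s m).stronglyMeasurable.aestronglyMeasurable x
      (hint m)] with ω hω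
    rw [hω]
    exact (s m).mem_range_self ω
  · have h0 : Tendsto (fun m => ∫⁻ ω, edist (f ω) (s m ω) ^ p ∂P) atTop (𝓝 (∫⁻ _, 0 ∂P)) := by
      refine tendsto_lintegral_of_dominated_convergence (fun ω => edist x (f ω) ^ p)
        (fun m => ?_) (fun m => Eventually.of_forall fun ω => ?_) hx.ne
        (Eventually.of_forall fun ω => ?_)
      · exact (continuous_edist.comp_stronglyMeasurable
          (f.stronglyMeasurable.prodMk (s m).stronglyMeasurable)).measurable.pow_const p
      · refine (ENNReal.rpow_le_rpow (edist_comm (f ω) (s m ω)).le hp0.le).trans ?_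
        exact ENNReal.rpow_le_rpow (SimpleFunc.edist_approxOn_le hfm hxA ω m) hp0.le
      · have h1 : Tendsto (fun m => s m ω) atTop (𝓝 (f ω)) :=
          SimpleFunc.tendsto_approxOn hfm hxA (subset_closure (Or.inl ⟨ω, rfl⟩))
        have h2 := (tendsto_const_nhds (x := f ω)).edist h1
        rw [edist_self] at h2
        have h3 := h2.ennrpow_const p
        rwa [ENNReal.zero_rpow_of_pos hp0] at h3
    have h1 := h0.ennrpow_const (1 / p)
    rw [lintegral_zero, ENNReal.zero_rpow_of_pos (by positivity)] at h1
    refine h1.congr fun m => ?_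
    rw [LpMap.edist_def]
    congr 1
    refine lintegral_congr_ae ?_
    filter_upwards [LpMap.coeFn_ofFun (s m) (s m).stronglyMeasurable.aestronglyMeasurable x
      (hint m)] with ω hω
    rw [hω]

end Density

/-! ### Almost everywhere convergence of orbit barycenters -/

section OrbitBarycenter

variable {Ω M : Type*} [MetricSpace M] [MeasurableSpace M] [BorelSpace M]
  {p : ℝ} [hp : Fact (1 ≤ p)]

/-- The barycenter of `(n+1)⁻¹ ∑_{k=0}^{n} δ_{f(T^k ω)}`. -/
def orbitBarycenter (T : Ω → Ω) (β : BaryMap M p) (f : Ω → M) (n : ℕ) (ω : Ω) : M :=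
  β (tupleP p fun k : Fin (n + 1) => f (T^[k] ω))

/-- Coupling `f (T^k ω)` with `g (T^k ω)` reduces the nonlinear averages to scalar ones, uniformly
in `β`. -/
theorem edist_orbitBarycenter_le (T : Ω → Ω) (β : BaryMap M p) (f g : Ω → M) (n : ℕ) (ω : Ω) :
    edist (orbitBarycenter T β f n ω) (orbitBarycenter T β g n ω) ≤
      orbitAverage T (fun ω => edist (f ω) (g ω) ^ p) n ω ^ (1 / p) := by
  refine (edist_tupleP_le β _ _).trans_eq ?_
  rw [orbitAverage, birkhoffSum,
    Fin.sum_univ_eq_sum_range (fun k => edist (f (T^[k] ω)) (g (T^[k] ω)) ^ p) (n + 1)]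

theorem tupleMeasure_orbit_singleton (T : Ω → Ω) (f : Ω → M) (n : ℕ) (ω : Ω) (a : M) :
    tupleMeasure (fun k : Fin (n + 1) => f (T^[k] ω)) {a} =
      orbitAverage T ((f ⁻¹' {a}).indicator 1) n ω := by
  rw [orbitAverage, birkhoffSum,
    ← Fin.sum_univ_eq_sum_range (fun k => (f ⁻¹' {a}).indicator 1 (T^[k] ω)) (n + 1)]
  simp only [tupleMeasure, Measure.smul_apply, Measure.coe_finsetSum, Finset.sum_apply,
    Measure.dirac_apply' _ (measurableSet_singleton a), smul_eq_mul]
  rfl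

theorem tupleMeasure_compl_eq_zero {n : ℕ} {x : Fin n → M} {F : Finset M} (h : ∀ k, x k ∈ F) :
    tupleMeasure x (F : Set M)ᶜ = 0 := by
  simp [tupleMeasure, Measure.dirac_apply' _ F.measurableSet.compl, h]

theorem edist_orbitBarycenter_le_mul_ediam (T : Ω → Ω) (β β' : BaryMap M p) {f : Ω → M} {ω : Ω}
    {F : Finset M} (h : ∀ k, f (T^[k] ω) ∈ F) (n : ℕ) :
    edist (orbitBarycenter T β f n ω) (orbitBarycenter T β' f n ω) ≤
      edist β β' * Metric.ediam (F : Set M) := by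
  refine (edist_tupleP_le_mul_ediam β β' _).trans ?_
  gcongr
  rintro _ ⟨k, rfl⟩
  exact h k

theorem orbitBarycenter_const (T : Ω → Ω) (β : BaryMap M p) (x : M) (n : ℕ) (ω : Ω) :
    orbitBarycenter T β (fun _ => x) n ω = x := by
  rw [orbitBarycenter, tupleP_const, β.map_dirac]

variable [MeasurableSpace Ω] {P : Measure Ω} {T : Ω → Ω}

/-- The null set comes only from the visit frequencies to the level sets of `f`, so it is chosen
before `β`. The second conclusion will give invariance of the limit. -/
theorem ae_cauchySeq_of_isFinitelyValued [IsProbabilityMeasure P] (hT : MeasurePreserving T P P)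
    {f : LpMap M p P} (hf : f.IsFinitelyValued) :
    ∀ᵐ ω ∂P, ∀ β : BaryMap M p, CauchySeq (fun n => orbitBarycenter T β f n ω) ∧
      Tendsto (fun n => edist (orbitBarycenter T β f n (T ω)) (orbitBarycenter T β f n ω)) atTop
        (𝓝 0) := by
  obtain ⟨F, hF⟩ := hf
  have hfm : Measurable (f : Ω → M) := f.stronglyMeasurable.measurable
  have h1 : ∀ᵐ ω ∂P, ∀ a ∈ F,
      Tendsto (fun n => orbitAverage T ((f ⁻¹' {a}).indicator 1) n ω) atTop
        (𝓝 (upperAverage T ((f ⁻¹' {a}).indicator 1) ω)) ∧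
      Tendsto (fun n => orbitAverage T ((f ⁻¹' {a}).indicator 1) n (T ω)) atTop
        (𝓝 (upperAverage T ((f ⁻¹' {a}).indicator 1) ω)) :=
    (Finset.eventually_all F).2 fun a _ =>
      ae_tendsto_orbitAverage_indicator hT (hfm (measurableSet_singleton a))
  filter_upwards [h1, ae_forall_iterate_mem hT hF] with ω h1 h2 β
  have h2' : ∀ k, f (T^[k] (T ω)) ∈ F := fun k => by
    rw [← Function.iterate_succ_apply]; exact h2 _
  constructor
  · refine EMetric.cauchySeq_iff.2 fun ε hε => ?_
    have key := tendsto_edist_of_tendsto_measure_singleton β (l := atTop ×ˢ atTop) F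
      (μ := fun k : ℕ × ℕ => tupleP p fun j : Fin (k.1 + 1) => f (T^[j] ω))
      (ν := fun k : ℕ × ℕ => tupleP p fun j : Fin (k.2 + 1) => f (T^[j] ω))
      (L := fun a => upperAverage T ((f ⁻¹' {a}).indicator 1) ω)
      (fun k => tupleMeasure_compl_eq_zero fun j => h2 j)
      (fun k => tupleMeasure_compl_eq_zero fun j => h2 j)
      (fun a ha => by
        simp only [tupleP, tupleMeasure_orbit_singleton]
        exact (h1 a ha).1.comp tendsto_fst)
      (fun a ha => by
        simp only [tupleP, tupleMeasure_orbit_singleton]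
        exact (h1 a ha).1.comp tendsto_snd)
    obtain ⟨N, hN⟩ := (eventually_atTop_prod_self'.1
      (by simpa only [prod_atTop_atTop_eq] using key.eventually_lt_const hε))
    exact ⟨N, fun m hm n hn => hN m hm n hn⟩
  · exact tendsto_edist_of_tendsto_measure_singleton β F
      (μ := fun n : ℕ => tupleP p fun j : Fin (n + 1) => f (T^[j] (T ω)))
      (ν := fun n : ℕ => tupleP p fun j : Fin (n + 1) => f (T^[j] ω))
      (L := fun a => upperAverage T ((f ⁻¹' {a}).indicator 1) ω)
      (fun k => tupleMeasure_compl_eq_zero fun j => h2' j)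
      (fun k => tupleMeasure_compl_eq_zero fun j => h2 j)
      (fun a ha => by
        simp only [tupleP, tupleMeasure_orbit_singleton]
        exact (h1 a ha).2)
      (fun a ha => by
        simp only [tupleP, tupleMeasure_orbit_singleton]
        exact (h1 a ha).1)

theorem ae_tendsto_orbitBarycenter_of_ergodic [IsProbabilityMeasure P] (hT : Ergodic T P)
    {f : LpMap M p P} (hf : f.IsFinitelyValued) (β : BaryMap M p) :
    ∀ᵐ ω ∂P, Tendsto (fun n => orbitBarycenter T β f n ω) atTop (𝓝 (expect β f)) := by
  obtain ⟨F, hF⟩ := hf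
  have hmp := hT.toMeasurePreserving
  have hfm : Measurable (f : Ω → M) := f.stronglyMeasurable.measurable
  have h1 : ∀ᵐ ω ∂P, ∀ a ∈ F,
      Tendsto (fun n => orbitAverage T ((f ⁻¹' {a}).indicator 1) n ω) atTop
        (𝓝 (P (f ⁻¹' {a}))) := by
    refine (Finset.eventually_all F).2 fun a _ => ?_
    have ha := hfm (measurableSet_singleton a)
    filter_upwards [ae_tendsto_orbitAverage_indicator hmp ha,
      ae_upperAverage_indicator_eq_of_ergodic hT ha] with ω h h'
    rw [← h']
    exact h.1
  filter_upwards [h1, ae_forall_iterate_mem hmp hF] with ω h1 h2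
  rw [tendsto_iff_edist_tendsto_0]
  exact tendsto_edist_of_tendsto_measure_singleton β F
    (μ := fun n : ℕ => tupleP p fun j : Fin (n + 1) => f (T^[j] ω))
    (ν := fun _ => f.law) (L := fun a => P (f ⁻¹' {a}))
    (fun k => tupleMeasure_compl_eq_zero fun j => h2 j)
    (fun k => by
      change P.map f _ = 0
      rw [Measure.map_apply hfm F.measurableSet.compl]
      exact hF)
    (fun a ha => by
      simp only [tupleP, tupleMeasure_orbit_singleton]
      exact h1 a ha)
    (fun a ha => by
      have : f.law.1 {a} = P (f ⁻¹' {a}) := Measure.map_apply hfm (measurableSet_singleton a)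
      simp only [this]
      exact tendsto_const_nhds)

/-- The set where every `m` fails for `c` lies in each superlevel set, so the maximal inequality
bounds `c` times its measure by integrals tending to 0. No subsequence is needed, as `m` may depend
on `ω`. -/
theorem ae_upperAverage_arbitrarily_small [IsFiniteMeasure P] (hT : MeasurePreserving T P P)
    {f : ℕ → Ω → ℝ≥0∞} (hf : ∀ m, Measurable (f m))
    (h : Tendsto (fun m => ∫⁻ ω, f m ω ∂P) atTop (𝓝 0)) :
    ∀ᵐ ω ∂P, ∀ c > 0, ∃ m, upperAverage T (f m) ω ≤ c := by
  have key : ∀ c : ℝ≥0∞, 0 < c → c ≠ ∞ → ∀ᵐ ω ∂P, ∃ m, upperAverage T (f m) ω ≤ c := by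
    intro c hc hc'
    rw [ae_iff]
    have h1 : ∀ m, c * P {ω | ¬ ∃ m, upperAverage T (f m) ω ≤ c} ≤ ∫⁻ ω, f m ω ∂P := fun m => by
      refine (mul_le_mul_right (measure_mono fun ω hω => ?_) c).trans
        (mul_measure_lt_upperAverage_le hT (hf m) c)
      simp only [not_exists, not_le, Set.mem_ofPred_eq] at hω
      exact hω m
    have h2 := ge_of_tendsto' h h1
    simpa [hc.ne'] using h2
  have hall : ∀ᵐ ω ∂P, ∀ k : ℕ, ∃ m, upperAverage T (f m) ω ≤ ((k : ℝ≥0∞) + 1)⁻¹ :=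
    ae_all_iff.2 fun k => key _ (by simp) (by simp)
  filter_upwards [hall] with ω hω c hc
  obtain ⟨k, hk⟩ := ENNReal.exists_inv_nat_lt hc.ne'
  obtain ⟨m, hm⟩ := hω k
  refine ⟨m, hm.trans (le_trans ?_ hk.le)⟩
  gcongr
  exact le_self_add

theorem ae_orbitBarycenter_approx [IsFiniteMeasure P] (hT : MeasurePreserving T P P)
    {f : LpMap M p P} {S : ℕ → LpMap M p P} (hS : Tendsto (fun m => edist f (S m)) atTop (𝓝 0)) :
    ∀ᵐ ω ∂P, ∀ ε > 0, ∃ m, ∀ᶠ n in atTop, ∀ β : BaryMap M p,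
      edist (orbitBarycenter T β f n ω) (orbitBarycenter T β (S m) n ω) ≤ ε ∧
      edist (orbitBarycenter T β f n (T ω)) (orbitBarycenter T β (S m) n (T ω)) ≤ ε := by
  have hp0 : 0 < p := zero_lt_one.trans_le hp.out
  have h0 : Tendsto (fun m => ∫⁻ ω, edist (f ω) (S m ω) ^ p ∂P) atTop (𝓝 0) := by
    have := hS.ennrpow_const p
    simpa only [LpMap.edist_rpow, ENNReal.zero_rpow_of_pos hp0] using this
  filter_upwards [ae_upperAverage_arbitrarily_small hT
    (fun m => (f.measurable_edist (S m)).pow_const p) h0] with ω hω ε hε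
  obtain ⟨c, hc0, hc⟩ := exists_between (ENNReal.rpow_pos_of_nonneg hε hp0.le : 0 < ε ^ p)
  obtain ⟨m, hm⟩ := hω c hc0
  refine ⟨m, ?_⟩
  have hle : ∀ {ω' n}, orbitAverage T (fun ω => edist (f ω) (S m ω) ^ p) n ω' < ε ^ p →
      ∀ β : BaryMap M p,
        edist (orbitBarycenter T β f n ω') (orbitBarycenter T β (S m) n ω') ≤ ε := by
    intro ω' n h β
    refine (edist_orbitBarycenter_le T β f (S m) n ω').trans ?_
    rw [one_div, ENNReal.rpow_inv_le_iff hp0]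
    exact h.le
  filter_upwards [eventually_lt_of_limsup_lt (hm.trans_lt hc),
    eventually_lt_of_limsup_lt (((upperAverage_comp_le T _ ω).trans hm).trans_lt hc)] with n h1 h2 β
  exact ⟨hle h1 β, hle h2 β⟩

theorem ae_cauchySeq_orbitBarycenter [IsProbabilityMeasure P] (hT : MeasurePreserving T P P)
    (f : LpMap M p P) :
    ∀ᵐ ω ∂P, ∀ β : BaryMap M p, CauchySeq (fun n => orbitBarycenter T β f n ω) ∧
      Tendsto (fun n => edist (orbitBarycenter T β f n (T ω)) (orbitBarycenter T β f n ω)) atTop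
        (𝓝 0) := by
  obtain ⟨S, hSF, hS⟩ := f.exists_isFinitelyValued_tendsto
  filter_upwards [ae_orbitBarycenter_approx hT hS,
    ae_all_iff.2 fun m => ae_cauchySeq_of_isFinitelyValued hT (hSF m)] with ω h1 h2 β
  constructor
  · refine EMetric.cauchySeq_iff.2 fun ε hε => ?_
    have hε3 : 0 < ε / 3 := ENNReal.div_pos hε.ne' (by simp)
    obtain ⟨m, hm⟩ := h1 (ε / 3) hε3
    obtain ⟨N, hN⟩ := eventually_atTop.1 hm
    obtain ⟨N', hN'⟩ := EMetric.cauchySeq_iff.1 (h2 m β).1 (ε / 3) hε3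
    refine ⟨max N N', fun a ha b hb => ?_⟩
    refine (edist_triangle4 _ (orbitBarycenter T β (S m) a ω) (orbitBarycenter T β (S m) b ω)
      _).trans_lt ?_
    have e1 := (hN a (le_of_max_le_left ha) β).1
    have e2 := hN' a (le_of_max_le_right ha) b (le_of_max_le_right hb)
    have e3 := (hN b (le_of_max_le_left hb) β).1
    rw [edist_comm] at e3
    -- Adding strict inequalities requires finite terms, so `ε = ∞` is treated apart.
    have hfin : ε / 3 ≠ ∞ ∨ ε / 3 = ∞ := (eq_or_ne _ _).symm
    rcases hfin with hfin | hfin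
    · calc _ < ε / 3 + ε / 3 + ε / 3 :=
            ENNReal.add_lt_add_of_lt_of_le (by finiteness)
              (ENNReal.add_lt_add_of_le_of_lt (by finiteness) e1 e2) e3
        _ = ε := ENNReal.add_thirds ε
    · have : ε = ∞ := by
        by_contra h
        exact (ENNReal.div_lt_top h (by simp)).ne hfin
      rw [this]
      finiteness
  · refine ENNReal.tendsto_nhds_zero.2 fun ε hε => ?_
    have hε3 : 0 < ε / 3 := ENNReal.div_pos hε.ne' (by simp)
    obtain ⟨m, hm⟩ := h1 (ε / 3) hε3
    filter_upwards [hm, ENNReal.tendsto_nhds_zero.1 (h2 m β).2 (ε / 3) hε3] with n h3 h4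
    rw [← ENNReal.add_thirds ε]
    refine (edist_triangle4 _ (orbitBarycenter T β (S m) n (T ω)) (orbitBarycenter T β (S m) n ω)
      _).trans (add_le_add (add_le_add (h3 β).2 h4) ?_)
    rw [edist_comm]
    exact (h3 β).1

theorem stronglyMeasurable_orbitBarycenter (hT : Measurable T) (β : BaryMap M p)
    (f : LpMap M p P) (n : ℕ) : StronglyMeasurable (orbitBarycenter T β f n) :=
  (continuous_tupleP β n).comp_stronglyMeasurable
    (stronglyMeasurable_finite_pi fun k => f.stronglyMeasurable.comp_measurable (hT.iterate k))

/-- Fatou's lemma for limits of orbit barycenters. -/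
theorem lintegral_edist_limit_le (hT : MeasurePreserving T P P) (β : BaryMap M p) {f g F G : Ω → M}
    (hfg : Measurable fun ω => edist (f ω) (g ω))
    (hF : ∀ᵐ ω ∂P, Tendsto (fun n => orbitBarycenter T β f n ω) atTop (𝓝 (F ω)))
    (hG : ∀ᵐ ω ∂P, Tendsto (fun n => orbitBarycenter T β g n ω) atTop (𝓝 (G ω))) :
    ∫⁻ ω, edist (F ω) (G ω) ^ p ∂P ≤ ∫⁻ ω, edist (f ω) (g ω) ^ p ∂P := by
  have hp0 : 0 < p := zero_lt_one.trans_le hp.out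
  have hm : Measurable fun ω => edist (f ω) (g ω) ^ p := hfg.pow_const p
  calc _ ≤ ∫⁻ ω, liminf (fun n => orbitAverage T (fun ω => edist (f ω) (g ω) ^ p) n ω) atTop ∂P := by
        refine lintegral_mono_ae ?_
        filter_upwards [hF, hG] with ω h1 h2
        rw [← ((h1.edist h2).ennrpow_const p).liminf_eq]
        refine liminf_le_liminf (Eventually.of_forall fun n => ?_)
        rw [← ENNReal.le_rpow_inv_iff hp0, ← one_div]
        exact edist_orbitBarycenter_le T β f g n ω
    _ ≤ liminf (fun n => ∫⁻ ω, orbitAverage T (fun ω => edist (f ω) (g ω) ^ p) n ω ∂P) atTop :=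
        lintegral_liminf_le fun n => measurable_orbitAverage hT.measurable hm n
    _ = _ := by simp only [lintegral_orbitAverage hT hm, liminf_const]

theorem edist_expect_le [IsProbabilityMeasure P] (β : BaryMap M p) (f g : LpMap M p P) :
    edist (expect β f) (expect β g) ≤ edist f g :=
  (β.contractive _ _).trans (wasserstein_map_le (zero_le_one.trans hp.out) P
    f.stronglyMeasurable.measurable g.stronglyMeasurable.measurable)

theorem exists_isErgodicLimit [CompleteSpace M] [IsProbabilityMeasure P]
    (hT : MeasurePreserving T P P) (β : BaryMap M p) (f : LpMap M p P) :
    ∃ g : LpMap M p P, IsErgodicLimit T β f g := by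
  obtain ⟨g, hg, hlim⟩ := exists_stronglyMeasurable_limit_of_tendsto_ae
    (f := fun n => orbitBarycenter T β f n) (μ := P)
    (fun n => (stronglyMeasurable_orbitBarycenter hT.measurable β f n).aestronglyMeasurable)
    ((ae_cauchySeq_orbitBarycenter hT f).mono fun ω h => cauchySeq_tendsto_of_complete (h β).1)
  obtain ⟨x, hx⟩ := f.2
  have hmom : ∫⁻ ω, edist x (g ω) ^ p ∂P < ∞ := by
    -- The constant map `x` has all its orbit barycenters equal to `x`, so the Fatou bound transfers
    -- the moment of `f` to `g`.
    refine (lintegral_edist_limit_le hT β (f := fun _ => x) (F := fun _ => x) ?_ ?_ hlim).trans_lt hx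
    · exact (continuous_edist.comp_stronglyMeasurable
        (stronglyMeasurable_const.prodMk f.stronglyMeasurable)).measurable
    · simp only [orbitBarycenter_const]
      exact Eventually.of_forall fun ω => tendsto_const_nhds
  refine ⟨LpMap.ofFun g hg.aestronglyMeasurable x hmom, ?_⟩
  filter_upwards [hlim, LpMap.coeFn_ofFun g hg.aestronglyMeasurable x hmom] with ω h1 h2
  rw [h2]
  exact h1

/-! ### The limit map `Γ`: invariance, continuity, ergodic case -/

variable [CompleteSpace M] [IsProbabilityMeasure P]

theorem isErgodicLimit_Gam (hT : MeasurePreserving T P P) (β : BaryMap M p) (f : LpMap M p P) :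
    IsErgodicLimit T β f (Gam T β f) := by
  have h := exists_isErgodicLimit hT β f
  rw [Gam, dif_pos h]
  exact h.choose_spec

theorem ae_tendsto_Gam (hT : MeasurePreserving T P P) (β : BaryMap M p) (f : LpMap M p P) :
    ∀ᵐ ω ∂P, Tendsto (fun n => orbitBarycenter T β f n ω) atTop (𝓝 (Gam T β f ω)) :=
  isErgodicLimit_Gam hT β f

theorem ae_Gam_comp_eq (hT : MeasurePreserving T P P) (β : BaryMap M p) (f : LpMap M p P) :
    ∀ᵐ ω ∂P, Gam T β f (T ω) = Gam T β f ω := by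
  have h := ae_tendsto_Gam hT β f
  filter_upwards [h, hT.quasiMeasurePreserving.ae h, ae_cauchySeq_orbitBarycenter hT f]
    with ω h1 h2 h3
  exact edist_eq_zero.1 (tendsto_nhds_unique (h2.edist h1) (h3 β).2)

theorem edist_Gam_le (hT : MeasurePreserving T P P) (β : BaryMap M p) (f g : LpMap M p P) :
    edist (Gam T β f) (Gam T β g) ≤ edist f g :=
  ENNReal.rpow_le_rpow (lintegral_edist_limit_le hT β (f.measurable_edist g)
    (ae_tendsto_Gam hT β f) (ae_tendsto_Gam hT β g)) (by
      have := zero_lt_one.trans_le hp.out; positivity)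

theorem edist_Gam_le_of_forall_mem (hT : MeasurePreserving T P P) (β β' : BaryMap M p)
    {f : LpMap M p P} {F : Finset M} (hF : ∀ᵐ ω ∂P, f ω ∈ F) :
    edist (Gam T β f) (Gam T β' f) ≤ edist β β' * Metric.ediam (F : Set M) := by
  have hp0 : 0 < p := zero_lt_one.trans_le hp.out
  rw [LpMap.edist_def, one_div, ENNReal.rpow_inv_le_iff hp0]
  calc _ ≤ ∫⁻ _, (edist β β' * Metric.ediam (F : Set M)) ^ p ∂P := by
        refine lintegral_mono_ae ?_
        filter_upwards [ae_forall_iterate_mem hT hF, ae_tendsto_Gam hT β f,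
          ae_tendsto_Gam hT β' f] with ω h1 h2 h3
        exact ENNReal.rpow_le_rpow (le_of_tendsto' (h2.edist h3) fun n =>
          edist_orbitBarycenter_le_mul_ediam T β β' h1 n) hp0.le
    _ = _ := by simp

theorem continuous_Gam (hT : MeasurePreserving T P P) :
    Continuous fun q : BaryMap M p × LpMap M p P => Gam T q.1 q.2 := by
  refine continuous_iff_continuousAt.2 fun ⟨β, f⟩ => ?_
  refine tendsto_iff_edist_tendsto_0.2 (ENNReal.tendsto_nhds_zero.2 fun ε hε => ?_)
  obtain ⟨S, hSF, hS⟩ := f.exists_isFinitelyValued_tendsto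
  -- Four errors: replacing `q.2` by `f`, `f` by `S m`, `q.1` by `β`, and `S m` back by `f`. Only
  -- the third uses the finite range, and `m` is fixed before `q`.
  have hε4 : 0 < ε / 2 / 2 := ENNReal.half_pos (ENNReal.half_pos hε.ne').ne'
  obtain ⟨m, hm⟩ := (ENNReal.tendsto_nhds_zero.1 hS _ hε4).exists
  obtain ⟨F, hF⟩ := hSF m
  have h1 : Tendsto (fun q : BaryMap M p × LpMap M p P => edist q.2 f) (𝓝 (β, f)) (𝓝 0) :=
    tendsto_iff_edist_tendsto_0.1 (continuous_snd.tendsto (β, f))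
  have h2 : Tendsto (fun q : BaryMap M p × LpMap M p P => edist q.1 β * Metric.ediam (F : Set M))
      (𝓝 (β, f)) (𝓝 0) := by
    have h3 : Tendsto (fun q : BaryMap M p × LpMap M p P => edist q.1 β) (𝓝 (β, f)) (𝓝 0) :=
      tendsto_iff_edist_tendsto_0.1 (continuous_fst.tendsto (β, f))
    simpa using ENNReal.Tendsto.mul_const h3
      (.inr F.finite_toSet.isBounded.ediam_ne_top)
  filter_upwards [ENNReal.tendsto_nhds_zero.1 h1 _ hε4, ENNReal.tendsto_nhds_zero.1 h2 _ hε4]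
    with q hq1 hq2
  calc edist (Gam T q.1 q.2) (Gam T β f)
      ≤ edist (Gam T q.1 q.2) (Gam T q.1 f) + edist (Gam T q.1 f) (Gam T q.1 (S m)) +
          (edist (Gam T q.1 (S m)) (Gam T β (S m)) + edist (Gam T β (S m)) (Gam T β f)) :=
        (edist_triangle _ (Gam T q.1 (S m)) _).trans
          (add_le_add (edist_triangle _ _ _) (edist_triangle _ _ _))
    _ ≤ ε / 2 / 2 + ε / 2 / 2 + (ε / 2 / 2 + ε / 2 / 2) := by
        gcongr
        · exact (edist_Gam_le hT q.1 q.2 f).trans hq1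
        · exact (edist_Gam_le hT q.1 f (S m)).trans hm
        · exact (edist_Gam_le_of_forall_mem hT q.1 β hF).trans hq2
        · rw [edist_comm]
          exact (edist_Gam_le hT β f (S m)).trans hm
    _ = ε := by rw [ENNReal.add_halves, ENNReal.add_halves]

/-- For ergodic `T` the limit of the orbit barycenters is the constant `E^β(f)`. -/
theorem ae_Gam_eq_expect (hT : Ergodic T P) (β : BaryMap M p) (f : LpMap M p P) :
    ∀ᵐ ω ∂P, Gam T β f ω = expect β f := by
  have hp0 : 0 < p := zero_lt_one.trans_le hp.out
  have hmp := hT.toMeasurePreserving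
  obtain ⟨S, hSF, hS⟩ := f.exists_isFinitelyValued_tendsto
  have hm1 : Measurable fun ω => edist (Gam T β f ω) (expect β f) :=
    (continuous_edist.comp_stronglyMeasurable
      ((Gam T β f).stronglyMeasurable.prodMk stronglyMeasurable_const)).measurable
  -- The identity holds for the finitely valued `S m`, and both `Γ_β` and `E^β` are 1-Lipschitz.
  have hbound : ∀ m, (∫⁻ ω, edist (Gam T β f ω) (expect β f) ^ p ∂P) ^ (1 / p) ≤
      edist f (S m) + edist f (S m) := by
    intro m
    have hSm : ∀ᵐ ω ∂P, Gam T β (S m) ω = expect β (S m) := by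
      filter_upwards [ae_tendsto_Gam hmp β (S m),
        ae_tendsto_orbitBarycenter_of_ergodic hT (hSF m) β] with ω h1 h2
      exact tendsto_nhds_unique h1 h2
    refine (lintegral_triangle hp.out (Gam T β f).aestronglyMeasurable
      (Gam T β (S m)).aestronglyMeasurable aestronglyMeasurable_const).trans
      (add_le_add (edist_Gam_le hmp β f (S m)) ?_)
    have : ∫⁻ ω, edist (Gam T β (S m) ω) (expect β f) ^ p ∂P =
        ∫⁻ _, edist (expect β (S m)) (expect β f) ^ p ∂P := by
      refine lintegral_congr_ae ?_
      filter_upwards [hSm] with ω hω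
      rw [hω]
    rw [this, lintegral_edist_const_rpow, edist_comm]
    exact edist_expect_le β f (S m)
  have h0 : (∫⁻ ω, edist (Gam T β f ω) (expect β f) ^ p ∂P) ^ (1 / p) ≤ 0 := by
    have := hS.add hS
    rw [add_zero] at this
    exact ge_of_tendsto' this hbound
  have h1 : ∫⁻ ω, edist (Gam T β f ω) (expect β f) ^ p ∂P = 0 := by
    rw [one_div, ENNReal.rpow_inv_le_iff hp0, ENNReal.zero_rpow_of_pos hp0] at h0
    exact nonpos_iff_eq_zero.1 h0
  rw [lintegral_eq_zero_iff (hm1.pow_const p)] at h1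
  filter_upwards [h1] with ω hω
  have : edist (Gam T β f ω) (expect β f) = 0 := by simpa [hp0, hp0.not_gt] using hω
  exact edist_eq_zero.1 this

theorem edist_expect_eq (hT : Ergodic T P) (β β' : BaryMap M p) (f g : LpMap M p P) :
    edist (expect β f) (expect β' g) = edist (Gam T β f) (Gam T β' g) := by
  rw [LpMap.edist_def, ← lintegral_edist_const_rpow (P := P) (p := p)]
  congr 1
  refine lintegral_congr_ae ?_
  filter_upwards [ae_Gam_eq_expect hT β f, ae_Gam_eq_expect hT β' g] with ω h1 h2
  rw [h1, h2]

/-- Outside one null set, an approximant `S m` chosen for `ω` and `ε` serves every `β k` and `β'` at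
once. This uniformity gives pointwise convergence of the whole sequence. -/
theorem ae_tendsto_Gam_of_tendsto (hT : MeasurePreserving T P P) {β : ℕ → BaryMap M p}
    {β' : BaryMap M p} (hβ : Tendsto β atTop (𝓝 β')) (f : LpMap M p P) :
    ∀ᵐ ω ∂P, Tendsto (fun k => Gam T (β k) f ω) atTop (𝓝 (Gam T β' f ω)) := by
  obtain ⟨S, hSF, hS⟩ := f.exists_isFinitelyValued_tendsto
  choose F hF using hSF
  filter_upwards [ae_orbitBarycenter_approx hT hS, ae_tendsto_Gam hT β' f,
    ae_all_iff.2 fun k => ae_tendsto_Gam hT (β k) f,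
    ae_all_iff.2 fun m => ae_forall_iterate_mem hT (hF m)] with ω h1 h2 h3 h4
  refine tendsto_iff_edist_tendsto_0.2 (ENNReal.tendsto_nhds_zero.2 fun ε hε => ?_)
  have hε3 : 0 < ε / 3 := ENNReal.div_pos hε.ne' (by simp)
  obtain ⟨m, hm⟩ := h1 (ε / 3) hε3
  have h5 : Tendsto (fun k => edist (β k) β' * Metric.ediam (F m : Set M)) atTop (𝓝 0) := by
    simpa using ENNReal.Tendsto.mul_const (tendsto_iff_edist_tendsto_0.1 hβ)
      (.inr (F m).finite_toSet.isBounded.ediam_ne_top)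
  filter_upwards [ENNReal.tendsto_nhds_zero.1 h5 _ hε3] with k hk
  refine le_of_tendsto ((h3 k).edist h2) ?_
  filter_upwards [hm] with n hn
  rw [← ENNReal.add_thirds ε]
  refine (edist_triangle4 _ (orbitBarycenter T (β k) (S m) n ω) (orbitBarycenter T β' (S m) n ω)
    _).trans (add_le_add (add_le_add (hn (β k)).1
      ((edist_orbitBarycenter_le_mul_ediam T (β k) β' (h4 m) n).trans hk)) ?_)
  rw [edist_comm]
  exact (hn β').1

end OrbitBarycenter

end

end BaryErgodic

theorem theorem5p2 {Ω M : Type*} [MeasurableSpace Ω] (P : Measure Ω) [IsProbabilityMeasure P]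
    [MetricSpace M] [CompleteSpace M] [MeasurableSpace M] [BorelSpace M]
    (p : ℝ) [Fact (1 ≤ p)] (T : Ω → Ω) (hT : MeasurePreserving T P P) :
    (∀ (β : BaryErgodic.BaryMap M p) (φ : BaryErgodic.LpMap M p P),
      BaryErgodic.IsErgodicLimit T β φ (BaryErgodic.Gam T β φ) ∧
      ∀ᵐ ω ∂P, BaryErgodic.Gam T β φ (T ω) = BaryErgodic.Gam T β φ ω) ∧
    Continuous (fun q : BaryErgodic.BaryMap M p × BaryErgodic.LpMap M p P =>
      BaryErgodic.Gam T q.1 q.2) ∧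
    (Ergodic T P →
      ∀ (β : ℕ → BaryErgodic.BaryMap M p) (β' : BaryErgodic.BaryMap M p)
        (φ : ℕ → BaryErgodic.LpMap M p P) (φ' : BaryErgodic.LpMap M p P),
        Tendsto β atTop (𝓝 β') → Tendsto φ atTop (𝓝 φ') →
        Tendsto (fun k => BaryErgodic.expect (β k) (φ k)) atTop
          (𝓝 (BaryErgodic.expect β' φ'))) ∧
    (StandardBorelSpace Ω →
      ∀ (β : ℕ → BaryErgodic.BaryMap M p) (β' : BaryErgodic.BaryMap M p),
        Tendsto β atTop (𝓝 β') →
        ∀ φ : BaryErgodic.LpMap M p P,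
          ∀ᵐ ω ∂P, Tendsto (fun k => BaryErgodic.Gam T (β k) φ ω) atTop
            (𝓝 (BaryErgodic.Gam T β' φ ω))) := by
  refine ⟨fun β φ => ⟨BaryErgodic.isErgodicLimit_Gam hT β φ, BaryErgodic.ae_Gam_comp_eq hT β φ⟩,
    BaryErgodic.continuous_Gam hT, fun hE β β' φ φ' hβ hφ => ?_,
    fun _ β β' hβ φ => BaryErgodic.ae_tendsto_Gam_of_tendsto hT hβ φ⟩
  -- For ergodic `T`, distances between expectations are `𝐝_p`-distances between the constant maps
  -- `Γ`, so joint continuity of `Γ` carries over.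
  have h := ((BaryErgodic.continuous_Gam hT).tendsto (β', φ')).comp (hβ.prodMk_nhds hφ)
  rw [tendsto_iff_edist_tendsto_0] at h ⊢
  simp only [BaryErgodic.edist_expect_eq hE]
  exact h
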